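/- Let $(A,\mathfrak m)$ be a (Noetherian) Cohen–Macaulay local ring of dimension two whose associated graded ring $G(A)=\bigoplus_{n\ge 0}\mathfrak m^n/\mathfrak m^{n+1}$ is Cohen–Macaulay. For an $A$-module $M$ put $G(M)=\bigoplus_{n\ge 0}\mathfrak m^nM/\mathfrak m^{n+1}M$, a graded $G(A)$-module; $G(M)$ is Cohen–Macaulay if its depth (its grade with respect to the homogeneous maximal ideal of $G(A)$) equals its Krull dimension. A maximal Cohen–Macaulay (MCM) module over a local ring $R$ is a nonzero finitely generated module of depth $\dim R$; it is Ulrich if its multiplicity equals its minimal number of generators. (1) Let $B=A/I$ be any one-dimensional Cohen–Macaulay quotient ring of $A$, let $E$ be any Ulrich $B$-module, and let $M=\operatorname{Syz}^A_1(E)$ be the first syzygy of $E$ over $A$, i.e. the kernel of a minimal free cover $A^{\mu(E)}\to E$. Then $M$ is an MCM $A$-module and $G(M)$ is Cohen–Macaulay. If moreover $A$ is not regular, then $M$ is not free. (2) Such $B$ and $E$ exist. In particular there is an MCM $A$-module $M$ with $G(M)$ Cohen–Macaulay, and $M$ can be chosen non-free if $A$ is not regular. -/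

import Mathlib

universe u

open IsLocalRing RingTheory.Sequence

noncomputable section

namespace GradedCM

/-- The depth (grade) of `M` in the ideal `I`: the supremum of the lengths of the `M`-regular
sequences contained in `I`. -/
def depth {R : Type*} [CommRing R] (I : Ideal R) (M : Type*) [AddCommGroup M] [Module R M] : ℕ∞ :=
  ⨆ (rs : List R) (_ : IsRegular M rs) (_ : ∀ r ∈ rs, r ∈ I), (rs.length : ℕ∞)

/-- Cohen-Macaulay local rings: Noetherian local rings whose depth is their dimension. -/
class IsCohenMacaulayLocalRing (A : Type*) [CommRing A] : Prop extends
    IsLocalRing A, IsNoetherianRing A where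
  depth_eq : (depth (maximalIdeal A) A : WithBot ℕ∞) = ringKrullDim A

/-- Maximal Cohen-Macaulay modules over a local ring `A`: nonzero finitely generated modules
whose depth is `dim A`. -/
structure IsMaximalCohenMacaulay (A : Type*) [CommRing A] [IsLocalRing A]
    (M : Type*) [AddCommGroup M] [Module A M] : Prop where
  finite : Module.Finite A M
  nontrivial : Nontrivial M
  depth_eq : (depth (maximalIdeal A) M : WithBot ℕ∞) = ringKrullDim A

/-- `e` is the multiplicity of the module `N` over the local ring `A`, where `𝔪` is the maximal
ideal and `r = dim N`: the length of `N / 𝔪 ^ (n + 1) N` agrees for large `n` with a polynomial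
in `n` of degree `r` with leading coefficient `e / r!`. -/
def HasMultiplicity (A : Type*) [CommRing A] [IsLocalRing A]
    (N : Type*) [AddCommGroup N] [Module A N] (e : ℕ) : Prop :=
  ∃ (r : ℕ) (P : Polynomial ℚ), Module.supportDim A N = r ∧
    (∀ᶠ n : ℕ in Filter.atTop, ∃ l : ℕ,
      Module.length A (N ⧸ (maximalIdeal A ^ (n + 1) • ⊤ : Submodule A N)) = l ∧
      P.eval (n : ℚ) = l) ∧
    P.natDegree = r ∧ P.leadingCoeff * (r.factorial : ℚ) = e

/-- Ulrich modules: maximal Cohen-Macaulay modules whose multiplicity is their minimal number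
of generators. -/
structure IsUlrich (A : Type*) [CommRing A] [IsLocalRing A]
    (U : Type*) [AddCommGroup U] [Module A U] : Prop where
  isMaximalCohenMacaulay : IsMaximalCohenMacaulay A U
  hasMultiplicity : HasMultiplicity A U (⊤ : Submodule A U).spanFinrank

/-- `M` is the first syzygy of `E` over the local ring `A`: it is isomorphic to the kernel of a
minimal free cover `A ^ n → E`. -/
def IsFirstSyzygy (A : Type*) [CommRing A] [IsLocalRing A] (E : Type*) [AddCommGroup E] [Module A E]
    (M : Type*) [AddCommGroup M] [Module A M] : Prop :=
  ∃ (n : ℕ) (ε : (Fin n → A) →ₗ[A] E), Function.Surjective ε ∧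
    LinearMap.ker ε ≤ maximalIdeal A • (⊤ : Submodule A (Fin n → A)) ∧
    Nonempty (M ≃ₗ[A] LinearMap.ker ε)

section AssociatedGraded

variable (A : Type u) [CommRing A] [IsLocalRing A]

/-- The Rees algebra `⨁ 𝔪 ^ n t ^ n` of the maximal ideal `𝔪`, as a subring of `A[t]`. -/
def Rees : Type u := reesAlgebra (maximalIdeal A)

instance : CommRing (Rees A) := inferInstanceAs (CommRing (reesAlgebra (maximalIdeal A)))

instance : Algebra A (Rees A) := inferInstanceAs (Algebra A (reesAlgebra (maximalIdeal A)))

/-- The ideal `⨁_{n ≥ 1} 𝔪 ^ n t ^ n` of the Rees algebra. -/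
def reesPositive : Ideal (Rees A) :=
  RingHom.ker ((Polynomial.constantCoeff (R := A)).comp
    (reesAlgebra (maximalIdeal A)).toSubring.subtype)

/-- The ideal `⨁ 𝔪 ^ (n + 1) t ^ n` of the Rees algebra, i.e. the extension of `𝔪`. -/
def reesMaximal : Ideal (Rees A) := (maximalIdeal A).map (algebraMap A (Rees A))

/-- The associated graded ring `G(A) = ⨁ 𝔪 ^ n / 𝔪 ^ (n + 1)`, as the quotient of the Rees algebra
`⨁ 𝔪 ^ n t ^ n` by its ideal `⨁ 𝔪 ^ (n + 1) t ^ n`. -/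
def AssocGradedRing : Type u := Rees A ⧸ reesMaximal A

instance : CommRing (AssocGradedRing A) := inferInstanceAs (CommRing (Rees A ⧸ reesMaximal A))

/-- The ideal `⨁_{n ≥ 1} 𝔪 ^ n / 𝔪 ^ (n + 1)` of `G(A)`, its only homogeneous maximal ideal. -/
def irrelevant : Ideal (AssocGradedRing A) :=
  (reesPositive A).map (Ideal.Quotient.mk (reesMaximal A))

variable (M : Type u) [AddCommGroup M] [Module A M]

/-- The module `⨁ 𝔪 ^ n M t ^ n` over the Rees algebra, inside `M[t]`. -/
def ReesModule : Type u := ((maximalIdeal A).stableFiltration (⊤ : Submodule A M)).submodule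

instance : AddCommGroup (ReesModule A M) := inferInstanceAs
  (AddCommGroup ((maximalIdeal A).stableFiltration (⊤ : Submodule A M)).submodule)

instance : Module (Rees A) (ReesModule A M) := inferInstanceAs (Module (reesAlgebra (maximalIdeal A))
  ((maximalIdeal A).stableFiltration (⊤ : Submodule A M)).submodule)

/-- The associated graded module `G(M) = ⨁ 𝔪 ^ n M / 𝔪 ^ (n + 1) M` over `G(A)`, as the quotient
of `⨁ 𝔪 ^ n M t ^ n` by its submodule `⨁ 𝔪 ^ (n + 1) M t ^ n`. -/
def AssocGraded : Type u :=
  ReesModule A M ⧸ (reesMaximal A • ⊤ : Submodule (Rees A) (ReesModule A M))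

instance : AddCommGroup (AssocGraded A M) := inferInstanceAs
  (AddCommGroup (ReesModule A M ⧸ (reesMaximal A • ⊤ : Submodule (Rees A) (ReesModule A M))))

instance : Module (AssocGradedRing A) (AssocGraded A M) := inferInstanceAs
  (Module (Rees A ⧸ reesMaximal A)
    (ReesModule A M ⧸ (reesMaximal A • ⊤ : Submodule (Rees A) (ReesModule A M))))

/-- A (finitely generated, graded, nonzero) module over `G(A)` is Cohen-Macaulay if its depth, i.e.
its grade in the homogeneous maximal ideal, is its Krull dimension. -/
def IsGradedCohenMacaulay (N : Type*) [AddCommGroup N] [Module (AssocGradedRing A) N] : Prop :=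
  (depth (irrelevant A) N : WithBot ℕ∞) = Module.supportDim (AssocGradedRing A) N

end AssociatedGraded

end GradedCM

end

/-!
Let `0 → M → F → E → 0` be exact, where `F` is free of rank `μ(E)` and `E` is an Ulrich module over
the one-dimensional ring `B`. The lengths of `𝔪ⁿE / 𝔪ⁿ⁺¹E` are eventually equal to `μ(E)`, so that
after a faithfully flat extension making the residue field infinite, a superficial element `x` of
`𝔪` satisfies `𝔪 E = x E`. From this, `M ∩ 𝔪ⁿ⁺¹F = 𝔪ⁿM` for all `n`; this equality descends to `A`
and says that `0 → G(M)(-1) → G(F) → G(E) → 0` is exact. As `G(E)` has positive depth, the depth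
lemma, applied to this sequence and to the given one, gives `G(M)` and `M` depth two. The dimension
of `G(A)` is two because `A` and the localization of `G(A)` at its homogeneous maximal ideal have
the same Hilbert–Samuel function, which determines the dimension of a Cohen–Macaulay local ring.

If `M` is free, comparing the lengths of `M / 𝔪M`, `F / 𝔪²F` and `E / 𝔪²E` gives
`d (μ(𝔪) + 1) = rank M + 2 d` with `d = rank F`; as `rank M ≤ d`, the ideal `𝔪` is generated by two
elements and `A` is regular.

For the existence, let `x` be the first element of a regular sequence of length two and `B = A/xA`.
The Hilbert–Samuel function of `B` is eventually linear, and `𝔪ⁿB` is Ulrich as soon as it is linear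
from `n` on.
-/

noncomputable section

namespace GradedCM

section Depth

open scoped Pointwise

variable {R : Type*} [CommRing R] {N : Type*} [AddCommGroup N] [Module R N] {I : Ideal R}

theorem quotSMulTop_mk_eq_zero_iff {f : R} {u : N} :
    (Submodule.Quotient.mk u : QuotSMulTop f N) = 0 ↔ ∃ w, f • w = u := by
  simp [Submodule.Quotient.mk_eq_zero, Submodule.mem_smul_pointwise_iff_exists]

theorem isWeaklyRegular_pair_iff {a b : R} :
    IsWeaklyRegular N [a, b] ↔ IsSMulRegular N a ∧ IsSMulRegular (QuotSMulTop a N) b := by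
  rw [isWeaklyRegular_cons_iff, isWeaklyRegular_singleton_iff]

theorem exists_isSMulRegular_of_forall_smul_eq_zero [IsNoetherianRing R] [Module.Finite R N]
    (h : ∀ n : N, (∀ r ∈ I, r • n = 0) → n = 0) : ∃ f ∈ I, IsSMulRegular N f := by
  by_contra! hI
  have hsub : (I : Set R) ⊆ ⋃ p ∈ associatedPrimes R N, (p : Set R) := by
    rw [biUnion_associatedPrimes_eq_compl_regular]
    exact hI
  obtain ⟨p, hp, hIp⟩ := (Ideal.subset_union_prime_finite (associatedPrimes.finite R N) ⊥ ⊥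
    (fun p hp _ _ => IsAssociatedPrime.isPrime hp)).1 hsub
  obtain ⟨hprime, n, rfl⟩ := isAssociatedPrime_iff.1 hp
  have hn : n = 0 := h n fun r hr => by
    simpa [Submodule.mem_colon_singleton] using hIp hr
  exact hprime.ne_top (by simp [hn])

theorem exists_isWeaklyRegular_of_le_depth {n : ℕ} (h : (n : ℕ∞) ≤ depth I N) :
    ∃ rs : List R, IsWeaklyRegular N rs ∧ (∀ r ∈ rs, r ∈ I) ∧ rs.length = n := by
  rcases Nat.eq_zero_or_pos n with rfl | hn
  · exact ⟨[], by simp⟩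
  have hlt : ((n - 1 : ℕ) : ℕ∞) < depth I N :=
    lt_of_lt_of_le (by exact_mod_cast Nat.sub_lt hn one_pos) h
  simp only [depth, lt_iSup_iff] at hlt
  obtain ⟨rs, hreg, hI, hlen⟩ := hlt
  have hlen : n ≤ rs.length := by
    have : n - 1 < rs.length := by exact_mod_cast hlen
    omega
  have happend := hreg.toIsWeaklyRegular
  rw [← List.take_append_drop n rs, isWeaklyRegular_append_iff] at happend
  exact ⟨rs.take n, happend.1, fun r hr => hI r (List.mem_of_mem_take hr), by simpa using hlen⟩

theorem exists_isWeaklyRegular_pair_of_two_le_depth (h : 2 ≤ depth I N) :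
    ∃ a ∈ I, ∃ b ∈ I, IsWeaklyRegular N [a, b] := by
  obtain ⟨rs, hrs, hmem, hlen⟩ := exists_isWeaklyRegular_of_le_depth (n := 2) h
  obtain ⟨a, b, rfl⟩ := List.length_eq_two.1 hlen
  exact ⟨a, hmem a (by simp), b, hmem b (by simp), hrs⟩

theorem le_depth_of_isRegular {rs : List R} (h : IsRegular N rs) (hI : ∀ r ∈ rs, r ∈ I) :
    (rs.length : ℕ∞) ≤ depth I N :=
  le_iSup_of_le rs (le_iSup_of_le h (le_iSup_of_le hI le_rfl))

theorem length_le_supportDim_of_isRegular [IsNoetherianRing R] [Module.Finite R N] {rs : List R}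
    (h : IsRegular N rs) : ((rs.length : ℕ∞) : WithBot ℕ∞) ≤ Module.supportDim R N := by
  induction rs generalizing N with
  | nil =>
    have := h.nontrivial
    obtain ⟨d, hd⟩ := WithBot.ne_bot_iff_exists.1
      (Module.supportDim_ne_bot_of_nontrivial (R := R) (M := N))
    rw [← hd]
    simp
  | cons x rs ih =>
    rw [isRegular_cons_iff] at h
    refine le_trans ?_ (Module.supportDim_quotSMulTop_succ_le_of_notMem_minimalPrimes (R := R)
      (M := N) (x := x) fun _ => h.1.notMem_of_mem_minimalPrimes)
    simpa using add_le_add_left (ih h.2) 1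

theorem depth_le_supportDim [IsNoetherianRing R] [Module.Finite R N] [Nontrivial N] (I : Ideal R) :
    (depth I N : WithBot ℕ∞) ≤ Module.supportDim R N := by
  obtain ⟨d, hd⟩ := WithBot.ne_bot_iff_exists.1
    (Module.supportDim_ne_bot_of_nontrivial (R := R) (M := N))
  rw [← hd, WithBot.coe_le_coe]
  refine iSup_le fun rs => iSup_le fun h => iSup_le fun _ => ?_
  have := length_le_supportDim_of_isRegular h
  rwa [← hd, WithBot.coe_le_coe] at this

theorem eq_zero_of_smul_eq_zero_quotSMulTop {a b f : R} (ha : a ∈ I) (hb : b ∈ I)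
    (hab : IsWeaklyRegular N [a, b]) (hf : IsSMulRegular N f) (n : QuotSMulTop f N)
    (hn : ∀ r ∈ I, r • n = 0) : n = 0 := by
  obtain ⟨hregA, hregB⟩ := isWeaklyRegular_pair_iff.1 hab
  obtain ⟨u, rfl⟩ := Submodule.Quotient.mk_surjective _ n
  have hdiv : ∀ r ∈ I, ∃ w, f • w = r • u := fun r hr => by
    rw [← quotSMulTop_mk_eq_zero_iff, Submodule.Quotient.mk_smul, hn r hr]
  obtain ⟨v, hv⟩ := hdiv a ha
  obtain ⟨w, hw⟩ := hdiv b hb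
  have hbv : a • w = b • v := hf <| by
    simp only
    rw [smul_comm f b v, hv, smul_comm f a w, hw, smul_comm]
  have hv0 : (Submodule.Quotient.mk v : QuotSMulTop a N) = 0 :=
    hregB.right_eq_zero_of_smul (quotSMulTop_mk_eq_zero_iff.2 ⟨w, hbv⟩)
  obtain ⟨v', rfl⟩ := quotSMulTop_mk_eq_zero_iff.1 hv0
  exact quotSMulTop_mk_eq_zero_iff.2 ⟨v', hregA (by simpa only [smul_comm a f] using hv)⟩

theorem quotSMulTop_map_injective_of_exact {L K : Type*} [AddCommGroup L] [Module R L]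
    [AddCommGroup K] [Module R K] {ι : L →ₗ[R] K} {π : K →ₗ[R] N} (hι : Function.Injective ι)
    (hex : Function.Exact ι π) {f : R} (hf : IsSMulRegular N f) :
    Function.Injective (QuotSMulTop.map f ι) := by
  rw [injective_iff_map_eq_zero]
  intro z hz
  obtain ⟨l, rfl⟩ := Submodule.Quotient.mk_surjective _ z
  obtain ⟨k, hk⟩ : ∃ k, f • k = ι l := quotSMulTop_mk_eq_zero_iff.1 hz
  have hπ : π k = 0 := hf.right_eq_zero_of_smul (by
    rw [← map_smul, hk, hex.apply_apply_eq_zero])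
  obtain ⟨l', rfl⟩ := (hex k).1 hπ
  exact quotSMulTop_mk_eq_zero_iff.2 ⟨l', hι (by rw [map_smul, hk])⟩

theorem exists_isWeaklyRegular_pair_of_exact [IsNoetherianRing R] [Module.Finite R N]
    {L K : Type*} [AddCommGroup L] [Module R L] [AddCommGroup K] [Module R K] [Module.Finite R K]
    {ι : L →ₗ[R] K} {π : K →ₗ[R] N} (hι : Function.Injective ι) (hex : Function.Exact ι π)
    {a b : R} (ha : a ∈ I) (hb : b ∈ I) (hab : IsWeaklyRegular K [a, b])
    (hN : ∀ n : N, (∀ r ∈ I, r • n = 0) → n = 0) :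
    ∃ f ∈ I, ∃ g ∈ I, IsWeaklyRegular L [f, g] := by
  have haK : IsSMulRegular K a := (isWeaklyRegular_pair_iff.1 hab).1
  obtain ⟨f, hfI, hf⟩ := exists_isSMulRegular_of_forall_smul_eq_zero (N := K × N) (I := I)
    fun ⟨k, n⟩ h => Prod.ext
      (haK.right_eq_zero_of_smul (congrArg Prod.fst (h a ha)))
      (hN n fun r hr => congrArg Prod.snd (h r hr))
  have hfK : IsSMulRegular K f := hf.of_injective (LinearMap.inl R K N) LinearMap.inl_injective
  have hfN : IsSMulRegular N f := hf.of_injective (LinearMap.inr R K N) LinearMap.inr_injective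
  obtain ⟨g, hgI, hg⟩ := exists_isSMulRegular_of_forall_smul_eq_zero
    (eq_zero_of_smul_eq_zero_quotSMulTop ha hb hab hfK)
  exact ⟨f, hfI, g, hgI, isWeaklyRegular_pair_iff.2 ⟨hfK.of_injective ι hι,
    hg.of_injective (QuotSMulTop.map f ι) (quotSMulTop_map_injective_of_exact hι hex hfN)⟩⟩

theorem IsCohenMacaulayLocalRing.two_le_depth {A : Type*} [CommRing A] [IsCohenMacaulayLocalRing A]
    (hdim : ringKrullDim A = 2) : 2 ≤ depth (maximalIdeal A) A := by
  have h := IsCohenMacaulayLocalRing.depth_eq (A := A)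
  rw [hdim] at h
  exact WithBot.coe_le_coe.1 h.ge

end Depth

section AssociatedGradedAPI

variable {A : Type u} [CommRing A] [IsLocalRing A]

namespace Rees

/-- The `n`-th coefficient of an element of the Rees algebra. -/
def coeff (n : ℕ) : Rees A →ₗ[A] A :=
  Polynomial.lcoeff A n ∘ₗ (reesAlgebra (maximalIdeal A)).val.toLinearMap

/-- The inclusion of the degree-`n` component: it sends `a ∈ 𝔪 ^ n` to `a t ^ n`. -/
def monomial (n : ℕ) : ↥(maximalIdeal A ^ n) →ₗ[A] Rees A :=
  (Polynomial.monomial n ∘ₗ (maximalIdeal A ^ n).subtype).codRestrict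
    (reesAlgebra (maximalIdeal A)).toSubmodule fun a => reesAlgebra.monomial_mem.2 a.2

theorem coeff_mem (n : ℕ) (r : Rees A) : coeff n r ∈ maximalIdeal A ^ n :=
  (r : reesAlgebra (maximalIdeal A)).2 n

@[ext] theorem ext {r s : Rees A} (h : ∀ n, coeff n r = coeff n s) : r = s :=
  Subtype.ext (Polynomial.ext h)

theorem coeff_one (n : ℕ) : coeff n (1 : Rees A) = if n = 0 then 1 else 0 :=
  Polynomial.coeff_one

theorem coeff_monomial (n m : ℕ) (a : ↥(maximalIdeal A ^ n)) :
    coeff m (monomial n a) = if n = m then (a : A) else 0 :=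
  Polynomial.coeff_monomial

theorem monomial_mul_monomial (n m : ℕ) (a : ↥(maximalIdeal A ^ n)) (b : ↥(maximalIdeal A ^ m)) :
    monomial n a * monomial m b =
      monomial (n + m) ⟨(a : A) * b, pow_add (maximalIdeal A) n m ▸ Ideal.mul_mem_mul a.2 b.2⟩ :=
  Subtype.ext (Polynomial.monomial_mul_monomial n m (a : A) (b : A))

theorem exists_eq_sum_monomial (r : Rees A) :
    ∃ D, r = ∑ n ∈ Finset.range D, monomial n ⟨coeff n r, coeff_mem n r⟩ := by
  refine ⟨(r : reesAlgebra (maximalIdeal A)).1.natDegree + 1, ext fun m => ?_⟩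
  simp only [map_sum, coeff_monomial, Finset.sum_ite_eq', Finset.mem_range]
  split_ifs with h
  · rfl
  · exact Polynomial.coeff_eq_zero_of_natDegree_lt (Nat.lt_of_succ_le (not_lt.1 h))

instance [IsNoetherianRing A] : IsNoetherianRing (Rees A) :=
  inferInstanceAs (IsNoetherianRing (reesAlgebra (maximalIdeal A)))

end Rees

theorem mem_reesPositive {r : Rees A} : r ∈ reesPositive A ↔ r.coeff 0 = 0 := Iff.rfl

theorem coeff_eq_zero_of_mem_reesPositive_pow {n : ℕ} {r : Rees A} (hr : r ∈ reesPositive A ^ n)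
    {j : ℕ} (hj : j < n) : r.coeff j = 0 := by
  let toPolynomial : Rees A →+* Polynomial A := (reesAlgebra (maximalIdeal A)).toSubring.subtype
  have hle : reesPositive A ≤ (Ideal.span {Polynomial.X}).comap toPolynomial := fun s hs =>
    Ideal.mem_span_singleton.2 (Polynomial.X_dvd_iff.2 hs)
  have hmem : toPolynomial r ∈ Ideal.span {Polynomial.X} ^ n :=
    Ideal.le_comap_pow toPolynomial n (Ideal.pow_right_mono hle n hr)
  rw [Ideal.span_singleton_pow, Ideal.mem_span_singleton, Polynomial.X_pow_dvd_iff] at hmem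
  exact hmem j hj

theorem coeff_mem_of_mem_reesMaximal {r : Rees A} (hr : r ∈ reesMaximal A) (n : ℕ) :
    r.coeff n ∈ maximalIdeal A ^ (n + 1) := by
  rw [reesMaximal, ← Submodule.restrictScalars_mem A (Ideal.map _ _), ← Ideal.smul_top_eq_map] at hr
  refine Submodule.smul_induction_on hr (fun a ha s _ => ?_) fun s t hs ht => ?_
  · rw [map_smul, pow_succ']
    exact Ideal.mul_mem_mul ha (s.coeff_mem n)
  · rw [map_add]
    exact add_mem hs ht

theorem map_mem_smul_top_of_coe_mem_smul {R P Q : Type*} [CommRing R] [AddCommGroup P] [Module R P]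
    [AddCommGroup Q] [Module R Q] (J : Ideal R) {L : Submodule R P} (f : L →ₗ[R] Q) {u : L}
    (hu : (u : P) ∈ J • L) : f u ∈ (J • ⊤ : Submodule R Q) :=
  (Submodule.map_smul'' J ⊤ f).trans_le (smul_mono_right J le_top)
    (Submodule.mem_map_of_mem (Submodule.mem_smul_top_iff J L u |>.2 hu))

theorem mem_reesMaximal {r : Rees A} :
    r ∈ reesMaximal A ↔ ∀ n, r.coeff n ∈ maximalIdeal A ^ (n + 1) := by
  refine ⟨coeff_mem_of_mem_reesMaximal, fun h => ?_⟩
  obtain ⟨D, hD⟩ := r.exists_eq_sum_monomial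
  rw [hD]
  refine sum_mem fun n _ => ?_
  rw [reesMaximal, ← Submodule.restrictScalars_mem A (Ideal.map _ _), ← Ideal.smul_top_eq_map]
  refine map_mem_smul_top_of_coe_mem_smul (maximalIdeal A) (Rees.monomial n) ?_
  simpa only [smul_eq_mul, ← pow_succ'] using h n

variable {M : Type u} [AddCommGroup M] [Module A M]

namespace ReesModule

instance : Module A (ReesModule A M) := inferInstanceAs
  (Module A ((maximalIdeal A).stableFiltration (⊤ : Submodule A M)).submodule)

instance : IsScalarTower A (Rees A) (ReesModule A M) := inferInstanceAs
  (IsScalarTower A (reesAlgebra (maximalIdeal A))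
    ((maximalIdeal A).stableFiltration (⊤ : Submodule A M)).submodule)

/-- The `n`-th coefficient of an element of the Rees module. -/
def coeff (n : ℕ) : ReesModule A M →ₗ[A] M where
  toFun p := PolynomialModule.coeff
    (p : ((maximalIdeal A).stableFiltration (⊤ : Submodule A M)).submodule).1 n
  map_add' _ _ := rfl
  map_smul' _ _ := rfl

/-- The inclusion of the degree-`n` component: it sends `u ∈ 𝔪 ^ n M` to `u t ^ n`. -/
def single (n : ℕ) : (maximalIdeal A ^ n • ⊤ : Submodule A M) →ₗ[A] ReesModule A M where
  toFun u := (⟨PolynomialModule.single A n (u : M), fun m => by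
    rw [PolynomialModule.coeff_single, Finsupp.single_apply]
    split_ifs with hm
    · exact hm ▸ u.2
    · exact zero_mem _⟩ : ((maximalIdeal A).stableFiltration (⊤ : Submodule A M)).submodule)
  map_add' u v := Subtype.ext (PolynomialModule.single_add n (u : M) v)
  map_smul' a u := Subtype.ext (PolynomialModule.single_smul n a (u : M))

theorem coeff_mem (n : ℕ) (p : ReesModule A M) :
    coeff n p ∈ (maximalIdeal A ^ n • ⊤ : Submodule A M) :=
  (p : ((maximalIdeal A).stableFiltration (⊤ : Submodule A M)).submodule).2 n

@[ext] theorem ext {p q : ReesModule A M} (h : ∀ n, coeff n p = coeff n q) : p = q :=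
  Subtype.ext (PolynomialModule.ext (Finsupp.ext h))

theorem coeff_smul (n : ℕ) (r : Rees A) (p : ReesModule A M) :
    coeff n (r • p) = ∑ x ∈ Finset.HasAntidiagonal.antidiagonal n, r.coeff x.1 • coeff x.2 p :=
  PolynomialModule.smul_apply _ _ n

theorem coeff_single (n m : ℕ) (u : (maximalIdeal A ^ n • ⊤ : Submodule A M)) :
    coeff m (single n u) = if n = m then (u : M) else 0 :=
  Finsupp.single_apply

theorem coeff_monomial_smul (n m : ℕ) (a : ↥(maximalIdeal A ^ n)) (p : ReesModule A M) :
    coeff m (Rees.monomial n a • p) = if n ≤ m then (a : A) • coeff (m - n) p else 0 :=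
  PolynomialModule.monomial_smul_apply _ _ _ _

theorem exists_eq_sum_single (p : ReesModule A M) :
    ∃ D, p = ∑ n ∈ Finset.range D, single n ⟨coeff n p, coeff_mem n p⟩ := by
  let q := PolynomialModule.coeff
    (p : ((maximalIdeal A).stableFiltration (⊤ : Submodule A M)).submodule).1
  obtain ⟨D, hD⟩ := q.support.bddAbove
  refine ⟨D + 1, ext fun m => ?_⟩
  simp only [map_sum, coeff_single, Finset.sum_ite_eq', Finset.mem_range, Nat.lt_succ_iff]
  split_ifs with hm
  · rfl
  · exact Finsupp.notMem_support_iff.1 fun hq : m ∈ q.support => hm (hD hq)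

instance [IsNoetherianRing A] [Module.Finite A M] : Module.Finite (Rees A) (ReesModule A M) :=
  Module.Finite.iff_fg (R := reesAlgebra (maximalIdeal A)).2 <|
    (((maximalIdeal A).stableFiltration (⊤ : Submodule A M)).submodule_fg_iff_stable
      fun _ => IsNoetherian.noetherian _).2 ((maximalIdeal A).stableFiltration_stable ⊤)

end ReesModule

theorem mem_reesMaximal_smul_top {p : ReesModule A M} :
    p ∈ (reesMaximal A • ⊤ : Submodule (Rees A) (ReesModule A M)) ↔
      ∀ n, p.coeff n ∈ (maximalIdeal A ^ (n + 1) • ⊤ : Submodule A M) := by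
  constructor
  · intro hp n
    refine Submodule.smul_induction_on hp (fun r hr q _ => ?_) fun p q hp hq => ?_
    · rw [ReesModule.coeff_smul]
      refine sum_mem fun x hx => ?_
      rw [← Finset.HasAntidiagonal.mem_antidiagonal.1 hx, add_right_comm, pow_add, mul_smul]
      exact Submodule.smul_mem_smul (mem_reesMaximal.1 hr _) (ReesModule.coeff_mem _ _)
    · rw [map_add]
      exact add_mem hp hq
  · intro h
    obtain ⟨D, hD⟩ := p.exists_eq_sum_single
    rw [hD]
    refine sum_mem fun n _ => ?_
    rw [reesMaximal, ← Submodule.restrictScalars_mem A, Ideal.smul_restrictScalars,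
      Submodule.restrictScalars_top]
    refine map_mem_smul_top_of_coe_mem_smul (maximalIdeal A) (ReesModule.single n) ?_
    simpa only [← mul_smul, ← pow_succ'] using h n

namespace AssocGradedRing

instance : Algebra A (AssocGradedRing A) := inferInstanceAs (Algebra A (Rees A ⧸ reesMaximal A))

instance : Algebra (Rees A) (AssocGradedRing A) :=
  inferInstanceAs (Algebra (Rees A) (Rees A ⧸ reesMaximal A))

instance [IsNoetherianRing A] : IsNoetherianRing (AssocGradedRing A) :=
  inferInstanceAs (IsNoetherianRing (Rees A ⧸ reesMaximal A))

/-- The projection from the Rees algebra to the associated graded ring. -/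
def mk : Rees A →ₐ[A] AssocGradedRing A := Ideal.Quotient.mkₐ A (reesMaximal A)

/-- The map sending `a ∈ 𝔪 ^ n` to its class in the degree-`n` component `𝔪 ^ n / 𝔪 ^ (n + 1)`. -/
def initialForm (n : ℕ) : ↥(maximalIdeal A ^ n) →ₗ[A] AssocGradedRing A :=
  mk.toLinearMap ∘ₗ Rees.monomial n

theorem mk_surjective : Function.Surjective (mk (A := A)) := Ideal.Quotient.mk_surjective

theorem mk_eq_zero {r : Rees A} : mk r = 0 ↔ ∀ n, r.coeff n ∈ maximalIdeal A ^ (n + 1) :=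
  Ideal.Quotient.eq_zero_iff_mem.trans mem_reesMaximal

theorem exists_mk_eq_sum_initialForm (r : Rees A) :
    ∃ D, mk r = ∑ n ∈ Finset.range D, initialForm n ⟨r.coeff n, r.coeff_mem n⟩ := by
  obtain ⟨D, hD⟩ := r.exists_eq_sum_monomial
  exact ⟨D, (congrArg mk hD).trans (map_sum mk _ _)⟩

theorem initialForm_eq_zero {n : ℕ} {a : ↥(maximalIdeal A ^ n)} :
    initialForm n a = 0 ↔ (a : A) ∈ maximalIdeal A ^ (n + 1) := by
  refine mk_eq_zero.trans ⟨fun h => ?_, fun h m => ?_⟩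
  · simpa [Rees.coeff_monomial] using h n
  · rw [Rees.coeff_monomial]
    split_ifs with hm
    · exact hm ▸ h
    · exact zero_mem _

theorem initialForm_mul_initialForm (n m : ℕ) (a : ↥(maximalIdeal A ^ n))
    (b : ↥(maximalIdeal A ^ m)) : initialForm n a * initialForm m b =
      initialForm (n + m)
        ⟨(a : A) * b, pow_add (maximalIdeal A) n m ▸ Ideal.mul_mem_mul a.2 b.2⟩ := by
  simp only [initialForm, LinearMap.comp_apply, AlgHom.toLinearMap_apply, ← map_mul,
    Rees.monomial_mul_monomial]

theorem initialForm_mem_irrelevant_pow {n : ℕ} (a : ↥(maximalIdeal A ^ n)) :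
    initialForm n a ∈ irrelevant A ^ n := by
  obtain ⟨a, ha⟩ := a
  induction n generalizing a with
  | zero => simp
  | succ n ih =>
    have hmul := pow_succ (maximalIdeal A) n
    refine Submodule.mul_induction_on' (M := maximalIdeal A ^ n) (N := maximalIdeal A)
      (C := fun a ha => initialForm (n + 1) ⟨a, hmul ▸ ha⟩ ∈ irrelevant A ^ (n + 1))
      ?_ ?_ (hmul ▸ ha)
    · intro x hx y hy
      let y' : ↥(maximalIdeal A ^ 1) := ⟨y, by simpa using hy⟩
      have hy' : initialForm 1 y' ∈ irrelevant A := Ideal.mem_map_of_mem _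
        (mem_reesPositive.2 (by simp [Rees.coeff_monomial]))
      have hxy := Ideal.mul_mem_mul (ih x hx) hy'
      rwa [initialForm_mul_initialForm, ← pow_succ] at hxy
    · intro x hx y hy hx' hy'
      exact map_add (initialForm (n + 1)) ⟨x, hmul ▸ hx⟩ ⟨y, hmul ▸ hy⟩ ▸ add_mem hx' hy'

theorem mk_mem_irrelevant_pow {n : ℕ} {r : Rees A} :
    mk r ∈ irrelevant A ^ n ↔ ∀ j < n, r.coeff j ∈ maximalIdeal A ^ (j + 1) := by
  constructor
  · intro h j hj
    have hmap : irrelevant A ^ n = (reesPositive A ^ n).map (Ideal.Quotient.mk (reesMaximal A)) :=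
      (Ideal.map_pow _ _ n).symm
    obtain ⟨s, hs, hsr⟩ :=
      (Ideal.mem_map_iff_of_surjective _ Ideal.Quotient.mk_surjective).1 (hmap ▸ h)
    have hsub : mk (r - s) = 0 := (map_sub mk r s).trans (sub_eq_zero.2 hsr.symm)
    simpa [coeff_eq_zero_of_mem_reesPositive_pow hs hj] using mk_eq_zero.1 hsub j
  · intro h
    obtain ⟨D, hD⟩ := exists_mk_eq_sum_initialForm r
    rw [hD]
    refine sum_mem fun j _ => ?_
    rcases lt_or_ge j n with hj | hj
    · rw [initialForm_eq_zero.2 (h j hj)]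
      exact zero_mem _
    · exact Ideal.pow_le_pow_right hj (initialForm_mem_irrelevant_pow _)

theorem mk_mem_irrelevant {r : Rees A} : mk r ∈ irrelevant A ↔ r.coeff 0 ∈ maximalIdeal A := by
  simpa using mk_mem_irrelevant_pow (n := 1) (r := r)

end AssocGradedRing

namespace AssocGraded

instance : Module (Rees A) (AssocGraded A M) := inferInstanceAs
  (Module (Rees A) (ReesModule A M ⧸ (reesMaximal A • ⊤ : Submodule (Rees A) (ReesModule A M))))

instance : IsScalarTower (Rees A) (AssocGradedRing A) (AssocGraded A M) := inferInstanceAs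
  (IsScalarTower (Rees A) (Rees A ⧸ reesMaximal A)
    (ReesModule A M ⧸ (reesMaximal A • ⊤ : Submodule (Rees A) (ReesModule A M))))

/-- The projection from the Rees module to the associated graded module. -/
def mk : ReesModule A M →ₗ[Rees A] AssocGraded A M := Submodule.mkQ _

theorem mk_surjective : Function.Surjective (mk (A := A) (M := M)) := Submodule.mkQ_surjective _

theorem mk_eq_zero {p : ReesModule A M} :
    mk p = 0 ↔ ∀ n, p.coeff n ∈ (maximalIdeal A ^ (n + 1) • ⊤ : Submodule A M) :=
  (Submodule.Quotient.mk_eq_zero _).trans mem_reesMaximal_smul_top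

theorem mk_smul_mk (r : Rees A) (p : ReesModule A M) :
    AssocGradedRing.mk r • mk p = mk (r • p) := rfl

instance [IsNoetherianRing A] [Module.Finite A M] :
    Module.Finite (AssocGradedRing A) (AssocGraded A M) :=
  have : Module.Finite (Rees A) (AssocGraded A M) := .of_surjective mk mk_surjective
  .of_restrictScalars_finite (Rees A) _ _

end AssocGraded

end AssociatedGradedAPI

section Superficial

theorem pow_smul_top_antitone {R L : Type*} [CommRing R] [AddCommGroup L] [Module R L]
    (I : Ideal R) : Antitone fun n => (I ^ n • ⊤ : Submodule R L) :=
  fun _ _ h => Submodule.smul_mono_left (Ideal.pow_le_pow_right h)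

theorem smul_mem_pow_succ_smul_top {R L : Type*} [CommRing R] [AddCommGroup L] [Module R L]
    {I : Ideal R} {a : R} {u : L} {n : ℕ} (ha : a ∈ I) (hu : u ∈ (I ^ n • ⊤ : Submodule R L)) :
    a • u ∈ (I ^ (n + 1) • ⊤ : Submodule R L) := by
  rw [pow_succ', mul_smul]
  exact Submodule.smul_mem_smul ha hu

variable {A : Type u} [CommRing A] [IsLocalRing A]

theorem AssocGradedRing.irrelevant_le_of_initialForm_one_mem {P : Ideal (AssocGradedRing A)}
    (h : ∀ a, initialForm 1 a ∈ P) : irrelevant A ≤ P := by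
  have hpos : ∀ n (a : ↥(maximalIdeal A ^ (n + 1))), initialForm (n + 1) a ∈ P := by
    rintro n ⟨a, ha⟩
    have hmul := pow_succ (maximalIdeal A) n
    refine Submodule.mul_induction_on' (M := maximalIdeal A ^ n) (N := maximalIdeal A)
      (C := fun a ha => initialForm (n + 1) ⟨a, hmul ▸ ha⟩ ∈ P) ?_ ?_ (hmul ▸ ha)
    · intro x hx y hy
      simpa only [initialForm_mul_initialForm] using
        P.mul_mem_left (initialForm n ⟨x, hx⟩) (h ⟨y, by simpa using hy⟩)
    · intro x hx y hy hx' hy'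
      exact map_add (initialForm (n + 1)) ⟨x, hmul ▸ hx⟩ ⟨y, hmul ▸ hy⟩ ▸ add_mem hx' hy'
  intro z hz
  obtain ⟨r, rfl⟩ := mk_surjective z
  obtain ⟨D, hD⟩ := exists_mk_eq_sum_initialForm r
  rw [hD]
  refine sum_mem fun n _ => ?_
  rcases n with _ | n
  · rw [initialForm_eq_zero.2 (by simpa using mk_mem_irrelevant.1 hz)]
    exact zero_mem P
  · exact hpos n _

theorem exists_forall_notMem_of_infinite_residueField {R L : Type*} [CommRing R] [IsLocalRing R]
    [Infinite (ResidueField R)] [AddCommGroup L] [Module R L] [Module.Finite R L]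
    {S : Set (Submodule R L)} (hS : S.Finite) (hne : ⊤ ∉ S) : ∃ x, ∀ W ∈ S, x ∉ W := by
  let V : Submodule R L → Subspace (ResidueField R) (TensorProduct R (ResidueField R) L) :=
    fun W => W.baseChange (ResidueField R)
  have hV : ∀ W ∈ S, V W ≠ ⊤ := fun W hW htop => by
    refine hne ((?_ : W = ⊤) ▸ hW)
    rw [← IsLocalRing.map_tensorProduct_mk_eq_top]
    have : (W.baseChange (ResidueField R)).restrictScalars R =
        (⊤ : Subspace (ResidueField R) _).restrictScalars R := congrArg _ htop
    rwa [Submodule.baseChange_eq_span, Submodule.restrictScalars_span R _ residue_surjective,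
      Submodule.span_eq, Submodule.restrictScalars_top] at this
  have hcov := Subspace.biUnion_ne_univ_of_top_notMem (s := (hS.image V).toFinset) (by
    simpa only [Set.Finite.mem_toFinset, Set.mem_image, not_exists, not_and] using hV)
  obtain ⟨v, hv⟩ := (Set.ne_univ_iff_exists_notMem _).1 hcov
  obtain ⟨x, rfl⟩ := TensorProduct.mk_surjective R L (ResidueField R) residue_surjective v
  simp only [Set.mem_iUnion, Set.Finite.mem_toFinset, Set.mem_image, not_exists] at hv
  exact ⟨x, fun W hW hx => hv (V W) ⟨W, hW, rfl⟩ (Submodule.tmul_mem_baseChange_of_mem 1 hx)⟩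

theorem exists_irrelevant_le_radical_annihilator_torsionBy [IsNoetherianRing A]
    [Infinite (ResidueField A)] (N : Type*) [AddCommGroup N] [Module (AssocGradedRing A) N]
    [Module.Finite (AssocGradedRing A) N] :
    ∃ a, irrelevant A ≤ (Module.annihilator (AssocGradedRing A)
      (Submodule.torsionBy (AssocGradedRing A) N (AssocGradedRing.initialForm 1 a))).radical := by
  let W : Ideal (AssocGradedRing A) → Submodule A ↥(maximalIdeal A ^ 1) := fun P =>
    (P.restrictScalars A).comap (AssocGradedRing.initialForm 1)
  let S : Set (Ideal (AssocGradedRing A)) :=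
    {P ∈ associatedPrimes (AssocGradedRing A) N | ¬ irrelevant A ≤ P}
  have hS : S.Finite := (associatedPrimes.finite _ _).subset (Set.sep_subset _ _)
  obtain ⟨a, ha⟩ := exists_forall_notMem_of_infinite_residueField (hS.image W) (by
    rintro ⟨P, hP, htop⟩
    exact hP.2 (AssocGradedRing.irrelevant_le_of_initialForm_one_mem
      fun b => (htop ▸ trivial : b ∈ W P)))
  refine ⟨a, ?_⟩
  rw [← Ideal.sInf_minimalPrimes]
  refine le_sInf fun P hP => ?_
  have hPN : IsAssociatedPrime P N := IsAssociatedPrime.map_of_injective (Submodule.subtype _)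
    (Module.associatedPrimes.minimalPrimes_annihilator_subset_associatedPrimes _ _ hP)
    (Submodule.injective_subtype _)
  by_contra hirr
  refine ha (W P) ⟨P, ⟨hPN, hirr⟩, rfl⟩ (hP.1.2 ?_)
  exact Module.mem_annihilator.2 fun k => Subtype.ext ((Submodule.mem_torsionBy_iff _ _).1 k.2)

variable {E : Type u} [AddCommGroup E] [Module A E]

/-- The filtration of `E` by the elements of `𝔪 ^ n E` whose multiple by `x` lies in
`𝔪 ^ (n + 2) E`; when `x ∈ 𝔪`, these represent the elements of degree `n` of `G(E)` annihilated
by the initial form of `x` in degree one. -/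
def initialAnnihilatorFiltration (E : Type u) [AddCommGroup E] [Module A E] (x : A) :
    (maximalIdeal A).Filtration E where
  N n := (maximalIdeal A ^ n • ⊤ : Submodule A E) ⊓
    ((maximalIdeal A ^ (n + 2) • ⊤ : Submodule A E).comap (LinearMap.lsmul A E x))
  mono n := inf_le_inf (pow_smul_top_antitone _ (Nat.le_succ n))
    (Submodule.comap_mono (pow_smul_top_antitone _ (Nat.le_succ (n + 2))))
  smul_le n := Submodule.smul_le.2 fun a ha u hu => by
    refine ⟨smul_mem_pow_succ_smul_top ha hu.1, ?_⟩
    change x • a • u ∈ (maximalIdeal A ^ (n + 2 + 1) • ⊤ : Submodule A E)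
    rw [smul_comm]
    exact smul_mem_pow_succ_smul_top ha hu.2

theorem exists_pow_smul_initialAnnihilatorFiltration_le [IsNoetherianRing A] {x : A}
    (hx : x ∈ maximalIdeal A ^ 1) (hrad : irrelevant A ≤ (Module.annihilator (AssocGradedRing A)
      (Submodule.torsionBy (AssocGradedRing A) (AssocGraded A E)
        (AssocGradedRing.initialForm 1 ⟨x, hx⟩))).radical) :
    ∃ c, ∀ n, maximalIdeal A ^ c • (initialAnnihilatorFiltration E x).N n ≤
      maximalIdeal A ^ (c + n + 1) • ⊤ := by
  obtain ⟨c, hc⟩ := Ideal.exists_pow_le_of_le_radical_of_fg hrad (IsNoetherian.noetherian _)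
  refine ⟨c, fun n => Submodule.smul_le.2 fun a ha v hv => ?_⟩
  have hv0 : AssocGradedRing.initialForm 1 ⟨x, hx⟩ •
      AssocGraded.mk (ReesModule.single n ⟨v, hv.1⟩) = 0 := by
    refine AssocGraded.mk_eq_zero.2 fun m => ?_
    rw [ReesModule.coeff_monomial_smul, ReesModule.coeff_single]
    split_ifs with h1 h2
    · rw [show m + 1 = n + 2 by omega]
      exact hv.2
    · simp
    · simp
  have ha0 : AssocGradedRing.initialForm c ⟨a, ha⟩ •
      AssocGraded.mk (ReesModule.single n ⟨v, hv.1⟩) = 0 :=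
    congrArg Subtype.val <| Module.mem_annihilator.1
      (hc (AssocGradedRing.initialForm_mem_irrelevant_pow ⟨a, ha⟩))
      ⟨_, (Submodule.mem_torsionBy_iff _ _).2 hv0⟩
  have hcoeff := AssocGraded.mk_eq_zero.1 ha0 (c + n)
  rwa [ReesModule.coeff_monomial_smul, if_pos (Nat.le_add_right c n), ReesModule.coeff_single,
    if_pos (Nat.add_sub_cancel_left c n).symm] at hcoeff

variable (E) in
/-- An element `x` of `𝔪` is superficial for `E` if its initial form in degree one is a
nonzerodivisor on `G(E)` in all large degrees. -/
def IsSuperficial (x : A) : Prop :=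
  x ∈ maximalIdeal A ∧ ∀ᶠ n in Filter.atTop, ∀ u ∈ (maximalIdeal A ^ n • ⊤ : Submodule A E),
    x • u ∈ (maximalIdeal A ^ (n + 2) • ⊤ : Submodule A E) →
    u ∈ (maximalIdeal A ^ (n + 1) • ⊤ : Submodule A E)

theorem exists_isSuperficial [IsNoetherianRing A] [Infinite (ResidueField A)] [Module.Finite A E] :
    ∃ x : A, IsSuperficial E x := by
  obtain ⟨⟨x, hx⟩, hrad⟩ :=
    exists_irrelevant_le_radical_annihilator_torsionBy (A := A) (AssocGraded A E)
  obtain ⟨c, hc⟩ := exists_pow_smul_initialAnnihilatorFiltration_le hx hrad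
  let F := initialAnnihilatorFiltration E x
  obtain ⟨n₀, hn₀⟩ := (((maximalIdeal A).stableFiltration_stable (⊤ : Submodule A E)).of_le
    (F' := F) fun _ => inf_le_left).exists_pow_smul_eq_of_ge
  refine ⟨x, by simpa using hx, Filter.eventually_atTop.2 ⟨n₀ + c, fun n hn u hu hxu => ?_⟩⟩
  obtain ⟨k, rfl⟩ := Nat.exists_eq_add_of_le hn
  have hstep : F.N (n₀ + c + k) = maximalIdeal A ^ c • F.N (n₀ + k) := by
    rw [hn₀ _ (by omega), hn₀ (n₀ + k) (by omega), ← mul_smul, ← pow_add]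
    congr 2
    omega
  have hmem : u ∈ F.N (n₀ + c + k) := ⟨hu, hxu⟩
  rw [hstep] at hmem
  convert hc _ hmem using 3
  omega

theorem exists_mem_pow_smul_top_of_smul_mem [IsNoetherianRing A] [Module.Finite A E]
    {x : A} (hreg : IsSMulRegular E x) :
    ∃ k, ∀ n ≥ k, ∀ u : E, x • u ∈ (maximalIdeal A ^ n • ⊤ : Submodule A E) →
      u ∈ (maximalIdeal A ^ (n - k) • ⊤ : Submodule A E) := by
  obtain ⟨k, hk⟩ := (maximalIdeal A).exists_pow_inf_eq_pow_smul
    (LinearMap.range (LinearMap.lsmul A E x))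
  refine ⟨k, fun n hn u hu => ?_⟩
  have hmem : x • u ∈ (maximalIdeal A ^ n • ⊤ : Submodule A E) ⊓
    LinearMap.range (LinearMap.lsmul A E x) := ⟨hu, ⟨u, rfl⟩⟩
  rw [hk n hn] at hmem
  have hmem := Submodule.smul_mono le_rfl inf_le_right hmem
  rw [LinearMap.range_eq_map, ← Submodule.map_smul''] at hmem
  obtain ⟨v, hv, hvu⟩ := hmem
  exact hreg hvu ▸ hv

namespace IsSuperficial

variable [IsNoetherianRing A] [Module.Finite A E] {x : A}

theorem isSMulRegular (hx : IsSuperficial E x) {y : A} (hy : y ∈ maximalIdeal A)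
    (hyE : IsSMulRegular E y) : IsSMulRegular E x := by
  obtain ⟨c, hc⟩ := Filter.eventually_atTop.1 hx.2
  refine isSMulRegular_iff_right_eq_zero_of_smul.2 fun u hu => ?_
  have hmem : ∀ n, y ^ c • u ∈ (maximalIdeal A ^ (c + n) • ⊤ : Submodule A E) := by
    intro n
    induction n with
    | zero => exact Submodule.smul_mem_smul (Ideal.pow_mem_pow hy c) trivial
    | succ n ih =>
      refine hc (c + n) (Nat.le_add_right c n) _ ih ?_
      rw [smul_comm, hu, smul_zero]
      exact zero_mem _
  have hinf : y ^ c • u ∈ (⨅ i : ℕ, maximalIdeal A ^ i • ⊤ : Submodule A E) :=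
    (Submodule.mem_iInf _).2 fun i => pow_smul_top_antitone _ (Nat.le_add_left i c) (hmem i)
  rw [Ideal.iInf_pow_smul_eq_bot_of_isLocalRing _ (maximalIdeal.isMaximal A).ne_top] at hinf
  exact (hyE.pow c).right_eq_zero_of_smul hinf

theorem eventually_mem_of_smul_mem (hx : IsSuperficial E x) (hreg : IsSMulRegular E x) :
    ∀ᶠ n in Filter.atTop, ∀ u : E, x • u ∈ (maximalIdeal A ^ (n + 1) • ⊤ : Submodule A E) →
      u ∈ (maximalIdeal A ^ n • ⊤ : Submodule A E) := by
  obtain ⟨c, hc⟩ := Filter.eventually_atTop.1 hx.2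
  obtain ⟨k, hk⟩ := exists_mem_pow_smul_top_of_smul_mem hreg
  refine Filter.eventually_atTop.2 ⟨k + c, fun n hn u hu => ?_⟩
  have hmem : ∀ j, c + j ≤ n → u ∈ (maximalIdeal A ^ (c + j) • ⊤ : Submodule A E) := by
    intro j
    induction j with
    | zero => exact fun _ => pow_smul_top_antitone _ (by omega) (hk (n + 1) (by omega) u hu)
    | succ j ih =>
      exact fun hj => hc (c + j) (by omega) u (ih (by omega))
        (pow_smul_top_antitone _ (by omega) hu)
  simpa only [Nat.add_sub_cancel' (show c ≤ n by omega)] using hmem (n - c) (by omega)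

end IsSuperficial

end Superficial

section HilbertSamuel

open scoped Pointwise

section Length

variable {R : Type*} [CommRing R] {L E : Type*} [AddCommGroup L] [Module R L] [AddCommGroup E]
  [Module R E]

theorem length_quotient_eq_length_quotient_comap_add (f : L →ₗ[R] E) (N : Submodule R E) :
    Module.length R (E ⧸ N) =
      Module.length R (L ⧸ N.comap f) + Module.length R (E ⧸ LinearMap.range f ⊔ N) := by
  let i : (L ⧸ N.comap f) →ₗ[R] E ⧸ N := Submodule.mapQ _ N f le_rfl
  have hle : N ≤ LinearMap.range f ⊔ N := le_sup_right
  refine Module.length_eq_add_of_exact i (Submodule.factor hle) ?_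
    (Submodule.factor_surjective hle) (LinearMap.exact_iff.2 ?_)
  · rw [← LinearMap.ker_eq_bot, Submodule.ker_mapQ, Submodule.mkQ_map_self]
  · rw [Submodule.factor, Submodule.ker_mapQ, Submodule.comap_id, Submodule.range_mapQ,
      Submodule.map_sup, Submodule.mkQ_map_self, sup_bot_eq]

theorem length_quotient_smul {y : R} (hy : IsSMulRegular E y) (N : Submodule R E) :
    Module.length R (E ⧸ y • N) =
      Module.length R (E ⧸ N) + Module.length R (QuotSMulTop y E) := by
  have hcomap : (y • N).comap (LinearMap.lsmul R E y) = N :=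
    Submodule.comap_map_eq_of_injective (f := LinearMap.lsmul R E y) hy N
  have hsup : LinearMap.range (LinearMap.lsmul R E y) ⊔ y • N = y • ⊤ :=
    (sup_eq_left.2 LinearMap.map_le_range).trans (LinearMap.range_eq_map _)
  rw [length_quotient_eq_length_quotient_comap_add (LinearMap.lsmul R E y), hcomap, hsup]

theorem eq_of_length_quotient_eq {N P : Submodule R E} (hle : N ≤ P)
    (h : Module.length R (E ⧸ N) = Module.length R (E ⧸ P)) (hP : Module.length R (E ⧸ P) ≠ ⊤) :
    N = P := by
  have hadd := Module.length_eq_add_of_exact _ _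
    (LinearMap.ker (Submodule.factor hle)).injective_subtype (Submodule.factor_surjective hle)
    (LinearMap.exact_subtype_ker_map _)
  rw [h] at hadd
  have hker : Module.length R (LinearMap.ker (Submodule.factor hle)) = 0 :=
    ENat.add_left_injective_of_ne_top hP (hadd.symm.trans (zero_add _).symm)
  rw [Module.length_eq_zero_iff, Submodule.subsingleton_iff_eq_bot, Submodule.factor,
    Submodule.ker_mapQ, Submodule.comap_id, ← LinearMap.le_ker_iff_map, Submodule.ker_mkQ] at hker
  exact le_antisymm hle hker

theorem isFiniteLength_quotient_pow_smul_top [IsLocalRing R] [IsNoetherianRing R]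
    [Module.Finite R E] (n : ℕ) :
    IsFiniteLength R (E ⧸ (maximalIdeal R ^ n • ⊤ : Submodule R E)) := by
  rcases eq_or_ne n 0 with rfl | hn
  · have : Subsingleton (E ⧸ (maximalIdeal R ^ 0 • ⊤ : Submodule R E)) :=
      Submodule.Quotient.subsingleton_iff.2 (by simp)
    exact .of_subsingleton
  have : Nontrivial (R ⧸ maximalIdeal R ^ n) := Ideal.Quotient.nontrivial_iff.2
    (ne_top_of_le_ne_top (maximalIdeal.isMaximal R).ne_top (Ideal.pow_le_self hn))
  have : IsLocalRing (R ⧸ maximalIdeal R ^ n) :=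
    .of_surjective' (Ideal.Quotient.mk _) Ideal.Quotient.mk_surjective
  have : IsArtinianRing (R ⧸ maximalIdeal R ^ n) := by
    refine (isArtinianRing_iff_isNilpotent_maximalIdeal _).2 ⟨n, ?_⟩
    rw [← map_maximalIdeal_of_surjective (Ideal.Quotient.mk (maximalIdeal R ^ n))
      Ideal.Quotient.mk_surjective, ← Ideal.map_pow, Ideal.map_quotient_self, Ideal.zero_eq_bot]
  have : Module.Finite (R ⧸ maximalIdeal R ^ n) (E ⧸ (maximalIdeal R ^ n • ⊤ : Submodule R E)) :=
    Module.Finite.of_restrictScalars_finite R _ _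
  rw [← Module.length_ne_top_iff, Module.length_eq_of_surjective
    (R := R ⧸ maximalIdeal R ^ n) Ideal.Quotient.mk_surjective]
  exact Module.length_ne_top

end Length

/-- The Hilbert–Samuel function `n ↦ ℓ(E / 𝔪 ^ n E)` of a module over a local ring. -/
def hilbertSamuel (A : Type*) [CommRing A] [IsLocalRing A] (E : Type*) [AddCommGroup E] [Module A E]
    (n : ℕ) : ℕ∞ :=
  Module.length A (E ⧸ (maximalIdeal A ^ n • ⊤ : Submodule A E))

section LocalRing

variable {A : Type*} [CommRing A] [IsLocalRing A] {E : Type*} [AddCommGroup E] [Module A E]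

theorem hilbertSamuel_ne_top [IsNoetherianRing A] [Module.Finite A E] (n : ℕ) :
    hilbertSamuel A E n ≠ ⊤ :=
  Module.length_ne_top_iff.2 (isFiniteLength_quotient_pow_smul_top n)

theorem hilbertSamuel_succ {x : A} (hx : x ∈ maximalIdeal A) {n : ℕ}
    (h : ∀ u : E, x • u ∈ (maximalIdeal A ^ (n + 1) • ⊤ : Submodule A E) →
      u ∈ (maximalIdeal A ^ n • ⊤ : Submodule A E)) :
    hilbertSamuel A E (n + 1) = hilbertSamuel A E n + Module.length A
      (E ⧸ (x • ⊤ ⊔ (maximalIdeal A ^ (n + 1) • ⊤) : Submodule A E)) := by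
  have hcomap : (maximalIdeal A ^ (n + 1) • ⊤ : Submodule A E).comap (LinearMap.lsmul A E x) =
      maximalIdeal A ^ n • ⊤ :=
    le_antisymm h fun u hu => smul_mem_pow_succ_smul_top hx hu
  rw [hilbertSamuel, length_quotient_eq_length_quotient_comap_add (LinearMap.lsmul A E x), hcomap,
    LinearMap.range_eq_map]
  rfl

theorem hilbertSamuel_succ_le {y : A} (hy : y ∈ maximalIdeal A) (hyE : IsSMulRegular E y) (n : ℕ) :
    hilbertSamuel A E (n + 1) ≤ hilbertSamuel A E n + Module.length A (QuotSMulTop y E) := by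
  have hle : y • (maximalIdeal A ^ n • ⊤ : Submodule A E) ≤ maximalIdeal A ^ (n + 1) • ⊤ := by
    rintro _ ⟨u, hu, rfl⟩
    exact smul_mem_pow_succ_smul_top hy hu
  rw [hilbertSamuel, hilbertSamuel, ← length_quotient_smul hyE]
  exact Module.length_le_of_surjective _ (Submodule.factor_surjective hle)

end LocalRing

end HilbertSamuel

section BaseChange

open scoped TensorProduct

variable {A : Type*} [CommRing A] {S : Type*} [CommRing S] [Algebra A S]
  {E : Type*} [AddCommGroup E] [Module A E]

theorem ker_baseChange_of_surjective {F : Type*} [AddCommGroup F] [Module A F] {ε : F →ₗ[A] E}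
    (hε : Function.Surjective ε) :
    LinearMap.ker (ε.baseChange S) = (LinearMap.ker ε).baseChange S :=
  Submodule.ext (lTensor_exact S (LinearMap.exact_subtype_ker_map ε) hε)

theorem baseChange_smul (I : Ideal A) (N : Submodule A E) :
    (I • N).baseChange S = I.map (algebraMap A S) • N.baseChange S := by
  apply le_antisymm
  · rw [Submodule.baseChange_eq_span, Submodule.span_le]
    rintro _ ⟨u, hu, rfl⟩
    refine Submodule.smul_induction_on hu (fun a ha v hv => ?_) (fun x y hx hy => ?_)
    · rw [map_smul, ← algebraMap_smul S a]
      exact Submodule.smul_mem_smul (Ideal.mem_map_of_mem _ ha)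
        (Submodule.tmul_mem_baseChange_of_mem _ hv)
    · exact map_add (TensorProduct.mk A S E 1) x y ▸ add_mem hx hy
  · rw [Ideal.map, Submodule.baseChange_eq_span, Submodule.span_smul_span, Submodule.span_le]
    rintro _ ⟨_, ⟨a, ha, rfl⟩, _, ⟨v, hv, rfl⟩, rfl⟩
    change algebraMap A S a • TensorProduct.mk A S E 1 v ∈ _
    rw [algebraMap_smul, ← map_smul]
    exact Submodule.tmul_mem_baseChange_of_mem _ (Submodule.smul_mem_smul ha hv)

theorem baseChange_pow_smul_top (I : Ideal A) (n : ℕ) :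
    (I ^ n • ⊤ : Submodule A E).baseChange S = (I.map (algebraMap A S)) ^ n • ⊤ := by
  rw [baseChange_smul, Submodule.baseChange_top, Ideal.map_pow]

theorem one_tmul_mem_baseChange [Module.FaithfullyFlat A S] {N : Submodule A E} {u : E} :
    (1 : S) ⊗ₜ[A] u ∈ N.baseChange S ↔ u ∈ N := by
  rw [← N.ker_mkQ, ← ker_baseChange_of_surjective N.mkQ_surjective, LinearMap.mem_ker,
    LinearMap.baseChange_tmul, Module.FaithfullyFlat.one_tmul_eq_zero_iff, LinearMap.mem_ker]

/-- Base change of a quotient module. -/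
def tensorQuotientEquiv (N : Submodule A E) :
    (S ⊗[A] (E ⧸ N)) ≃ₗ[S] (S ⊗[A] E) ⧸ N.baseChange S :=
  (Submodule.quotEquivOfEq _ _ (by
      rw [ker_baseChange_of_surjective N.mkQ_surjective, Submodule.ker_mkQ]) ≪≫ₗ
    LinearMap.quotKerEquivOfSurjective (N.mkQ.baseChange S)
      (LinearMap.baseChange_surjective S N.mkQ_surjective)).symm

theorem isSMulRegular_tensorProduct [Module.Flat A S] {y : A} (hy : IsSMulRegular E y) :
    IsSMulRegular (S ⊗[A] E) (algebraMap A S y) :=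
  (isSMulRegular_algebraMap_iff S).2 (hy.lTensor S)

theorem hilbertSamuel_tensorProduct [IsLocalRing A] [IsLocalRing S] [Module.FaithfullyFlat A S]
    (hS : (maximalIdeal A).map (algebraMap A S) = maximalIdeal S) (n : ℕ) :
    hilbertSamuel S (S ⊗[A] E) n = hilbertSamuel A E n := by
  have : IsLocalHom (algebraMap A S) := ((local_hom_TFAE (algebraMap A S)).out 0 2).2 hS.le
  have hone : Module.length S (S ⧸ maximalIdeal S) = 1 := Module.length_eq_one_iff.2
    (isSimpleModule_iff_quot_maximal.2 ⟨_, maximalIdeal.isMaximal S, ⟨.refl _ _⟩⟩)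
  rw [hilbertSamuel, ← hS, ← baseChange_pow_smul_top, ← (tensorQuotientEquiv _).length_eq,
    IsLocalRing.length_baseChange, hS, hone, mul_one, hilbertSamuel]

theorem exists_faithfullyFlat_infinite_residueField (A : Type u) [CommRing A] [IsLocalRing A]
    [IsNoetherianRing A] :
    ∃ (S : Type u) (_ : CommRing S) (_ : IsLocalRing S) (_ : IsNoetherianRing S) (_ : Algebra A S)
      (_ : Module.FaithfullyFlat A S),
      (maximalIdeal A).map (algebraMap A S) = maximalIdeal S ∧ Infinite (ResidueField S) := by
  let P : Ideal (Polynomial A) := (maximalIdeal A).map Polynomial.C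
  have hP : P.IsPrime := Ideal.isPrime_map_C_of_isPrime
  let S := Localization.AtPrime P
  have hmap : (maximalIdeal A).map (algebraMap A S) = maximalIdeal S := by
    rw [IsScalarTower.algebraMap_eq A (Polynomial A) S, ← Ideal.map_map,
      ← Localization.AtPrime.map_eq_maximalIdeal, Polynomial.algebraMap_eq]
  have hflat : Module.Flat A S := Module.Flat.trans A (Polynomial A) S
  have hloc : IsLocalHom (algebraMap A S) := ((local_hom_TFAE (algebraMap A S)).out 0 2).2 hmap.le
  refine ⟨S, inferInstance, inferInstance, IsLocalization.isNoetherianRing P.primeCompl S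
    inferInstance, inferInstance, Module.FaithfullyFlat.of_flat_of_isLocalHom, hmap, ?_⟩
  refine Infinite.of_injective
    (fun n : ℕ => residue S (algebraMap (Polynomial A) S (Polynomial.X ^ n))) fun i j hij => ?_
  by_contra hne
  have hmem : Polynomial.X ^ i - Polynomial.X ^ j ∈ P := by
    rw [← IsLocalization.AtPrime.to_map_mem_maximal_iff S P, map_sub, ← residue_eq_zero_iff,
      map_sub]
    exact sub_eq_zero.2 hij
  have hcoeff := Ideal.mem_map_C_iff.1 hmem i
  rw [Polynomial.coeff_sub, Polynomial.coeff_X_pow_self, Polynomial.coeff_X_pow, if_neg hne,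
    sub_zero] at hcoeff
  exact Ideal.one_notMem _ hcoeff

end BaseChange

section Ulrich

open scoped TensorProduct Pointwise

section SMulTop

variable {R : Type*} [CommRing R] {I : Ideal R} {F : Type*} [AddCommGroup F] [Module R F] {x : R}

theorem pow_succ_smul_top_eq_smul (h : (I • ⊤ : Submodule R F) = x • ⊤) (n : ℕ) :
    (I ^ (n + 1) • ⊤ : Submodule R F) = x • I ^ n • (⊤ : Submodule R F) := by
  rw [pow_succ, mul_smul, h]
  exact (Submodule.map_smul'' (I ^ n) ⊤ (LinearMap.lsmul R F x)).symm

theorem mem_pow_smul_top_of_smul_mem (h : (I • ⊤ : Submodule R F) = x • ⊤)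
    (hx : IsSMulRegular F x) {n : ℕ} {u : F}
    (hu : x • u ∈ (I ^ (n + 1) • ⊤ : Submodule R F)) : u ∈ (I ^ n • ⊤ : Submodule R F) := by
  rw [pow_succ_smul_top_eq_smul h] at hu
  obtain ⟨w, hw, hwu⟩ := hu
  exact hx hwu ▸ hw

theorem inf_pow_smul_top_le {M : Submodule R F} (hxI : x ∈ I) (hx : ∀ f, x • f ∈ M → f ∈ M)
    (hI : I • ⊤ ≤ x • ⊤ ⊔ M) (n : ℕ) : M ⊓ I ^ (n + 1) • ⊤ ≤ I ^ n • M := by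
  induction n with
  | zero => simp
  | succ n ih =>
    rintro m ⟨hm, hm'⟩
    have hsup : (I ^ (n + 1 + 1) • ⊤ : Submodule R F) ≤
        x • I ^ (n + 1) • (⊤ : Submodule R F) ⊔ I ^ (n + 1) • M := by
      rw [pow_succ I (n + 1), mul_smul]
      refine (Submodule.smul_mono le_rfl hI).trans_eq ?_
      rw [Submodule.smul_sup]
      exact congrArg (· ⊔ _) (Submodule.map_smul'' (I ^ (n + 1)) ⊤ (LinearMap.lsmul R F x)).symm
    obtain ⟨_, ⟨f, hf, rfl⟩, m', hm'', rfl⟩ := Submodule.mem_sup.1 (hsup hm')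
    have hfM : f ∈ M := hx f ((Submodule.add_mem_iff_left M (Submodule.smul_le_right hm'')).1 hm)
    refine add_mem ?_ hm''
    rw [pow_succ', mul_smul]
    exact Submodule.smul_mem_smul hxI (ih ⟨hfM, hf⟩)

end SMulTop

theorem smul_top_eq_of_eventually_hilbertSamuel_succ {A : Type*} [CommRing A] [IsLocalRing A]
    [IsNoetherianRing A] {E : Type*} [AddCommGroup E] [Module A E] [Module.Finite A E] {x : A}
    (hx : x ∈ maximalIdeal A)
    (hdiv : ∀ᶠ n in Filter.atTop, ∀ u : E, x • u ∈ (maximalIdeal A ^ (n + 1) • ⊤ : Submodule A E) →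
      u ∈ (maximalIdeal A ^ n • ⊤ : Submodule A E))
    (hH : ∀ᶠ n in Filter.atTop, hilbertSamuel A E (n + 1) =
      hilbertSamuel A E n + hilbertSamuel A E 1) :
    (maximalIdeal A • ⊤ : Submodule A E) = x • ⊤ := by
  have hxle : x • ⊤ ≤ (maximalIdeal A • ⊤ : Submodule A E) := by
    rintro _ ⟨u, -, rfl⟩
    exact Submodule.smul_mem_smul hx trivial
  obtain ⟨n, ⟨hdiv, hH⟩, hn⟩ := ((hdiv.and hH).and (Filter.eventually_ge_atTop 1)).exists
  rw [hilbertSamuel_succ hx hdiv] at hH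
  have hlength := ENat.add_right_injective_of_ne_top (hilbertSamuel_ne_top n) hH
  have hle : (x • ⊤ ⊔ maximalIdeal A ^ (n + 1) • ⊤ : Submodule A E) ≤ maximalIdeal A ^ 1 • ⊤ :=
    sup_le (by rwa [pow_one]) (pow_smul_top_antitone _ (by omega))
  have heq := eq_of_length_quotient_eq hle hlength (hilbertSamuel_ne_top 1)
  refine le_antisymm (Submodule.le_of_le_smul_of_le_jacobson_bot (IsNoetherian.noetherian _)
    (maximalIdeal_le_jacobson _) ?_) hxle
  rw [← mul_smul, ← pow_two]
  conv_lhs => rw [← pow_one (maximalIdeal A), ← heq]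
  exact sup_le_sup le_rfl (pow_smul_top_antitone _ (by omega))

/-- A module `E` of positive depth over a local ring such that `ℓ(𝔪 ^ n E / 𝔪 ^ (n + 1) E)` is
eventually equal to the number `ℓ(E / 𝔪 E)` of generators of `E`. This is what remains of the
Ulrich property over a one-dimensional ring, and it does not change when `E` is regarded as a module
over another ring of which the given one is a quotient. -/
structure HasUlrichGrowth (A : Type*) [CommRing A] [IsLocalRing A] (E : Type*) [AddCommGroup E]
    [Module A E] : Prop where
  exists_isSMulRegular : ∃ y ∈ maximalIdeal A, IsSMulRegular E y
  eventually_hilbertSamuel_succ : ∀ᶠ n in Filter.atTop, hilbertSamuel A E (n + 1) =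
    hilbertSamuel A E n + hilbertSamuel A E 1

theorem HasUlrichGrowth.tensorProduct {A : Type*} [CommRing A] [IsLocalRing A] {E : Type*}
    [AddCommGroup E] [Module A E] (h : HasUlrichGrowth A E) {S : Type*} [CommRing S]
    [IsLocalRing S] [Algebra A S] [Module.FaithfullyFlat A S]
    (hS : (maximalIdeal A).map (algebraMap A S) = maximalIdeal S) :
    HasUlrichGrowth S (S ⊗[A] E) where
  exists_isSMulRegular := by
    obtain ⟨y, hy, hyE⟩ := h.exists_isSMulRegular
    exact ⟨_, hS ▸ Ideal.mem_map_of_mem _ hy, isSMulRegular_tensorProduct hyE⟩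
  eventually_hilbertSamuel_succ := by
    simpa only [hilbertSamuel_tensorProduct hS] using h.eventually_hilbertSamuel_succ

section

variable {A : Type u} [CommRing A] [IsLocalRing A] [IsNoetherianRing A]
  {E : Type u} [AddCommGroup E] [Module A E] [Module.Finite A E]

namespace HasUlrichGrowth

theorem exists_smul_top_eq [Infinite (ResidueField A)] (h : HasUlrichGrowth A E) :
    ∃ x ∈ maximalIdeal A, IsSMulRegular E x ∧ (maximalIdeal A • ⊤ : Submodule A E) = x • ⊤ := by
  obtain ⟨y, hy, hyE⟩ := h.exists_isSMulRegular
  obtain ⟨x, hx⟩ := exists_isSuperficial (A := A) (E := E)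
  have hreg := hx.isSMulRegular hy hyE
  exact ⟨x, hx.1, hreg, smul_top_eq_of_eventually_hilbertSamuel_succ hx.1
    (hx.eventually_mem_of_smul_mem hreg) h.eventually_hilbertSamuel_succ⟩

theorem exists_extension_smul_top_eq (h : HasUlrichGrowth A E) :
    ∃ (S : Type u) (_ : CommRing S) (_ : IsLocalRing S) (_ : Algebra A S)
      (_ : Module.FaithfullyFlat A S), (maximalIdeal A).map (algebraMap A S) = maximalIdeal S ∧
      ∃ x ∈ maximalIdeal S, IsSMulRegular (S ⊗[A] E) x ∧
        (maximalIdeal S • ⊤ : Submodule S (S ⊗[A] E)) = x • ⊤ := by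
  obtain ⟨S, _, _, _, _, _, hS, _⟩ := exists_faithfullyFlat_infinite_residueField A
  exact ⟨S, _, _, _, ‹_›, hS, (h.tensorProduct hS).exists_smul_top_eq⟩

theorem mem_pow_smul_top_of_forall_smul_mem (h : HasUlrichGrowth A E) {n : ℕ} {u : E}
    (hu : ∀ a ∈ maximalIdeal A, a • u ∈ (maximalIdeal A ^ (n + 1) • ⊤ : Submodule A E)) :
    u ∈ (maximalIdeal A ^ n • ⊤ : Submodule A E) := by
  obtain ⟨S, _, _, _, _, hS, x, hx, hreg, hxS⟩ := h.exists_extension_smul_top_eq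
  rw [← one_tmul_mem_baseChange (S := S), baseChange_pow_smul_top, hS]
  refine GradedCM.mem_pow_smul_top_of_smul_mem hxS hreg ?_
  have hle : (maximalIdeal A).map (algebraMap A S) ≤
      (maximalIdeal S ^ (n + 1) • ⊤ : Submodule S (S ⊗[A] E)).comap
        (LinearMap.toSpanSingleton S _ ((1 : S) ⊗ₜ[A] u)) := by
    refine Ideal.map_le_iff_le_comap.2 fun a ha => ?_
    change algebraMap A S a • ((1 : S) ⊗ₜ[A] u) ∈
      (maximalIdeal S ^ (n + 1) • ⊤ : Submodule S (S ⊗[A] E))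
    rw [algebraMap_smul, ← TensorProduct.tmul_smul, ← hS, ← baseChange_pow_smul_top]
    exact Submodule.tmul_mem_baseChange_of_mem _ (hu a ha)
  exact hle (hS ▸ hx)

theorem hilbertSamuel_two (h : HasUlrichGrowth A E) :
    hilbertSamuel A E 2 = hilbertSamuel A E 1 + hilbertSamuel A E 1 := by
  obtain ⟨S, _, _, _, _, hS, x, hx, hreg, hxS⟩ := h.exists_extension_smul_top_eq
  have hsucc := hilbertSamuel_succ (E := S ⊗[A] E) hx (n := 1) fun _ =>
    GradedCM.mem_pow_smul_top_of_smul_mem hxS hreg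
  have hsup : (x • ⊤ ⊔ maximalIdeal S ^ (1 + 1) • ⊤ : Submodule S (S ⊗[A] E)) =
      maximalIdeal S ^ 1 • ⊤ := by
    rw [← hxS, pow_one]
    exact sup_eq_left.2 (Submodule.smul_mono_left (Ideal.pow_le_self two_ne_zero))
  rw [hsup] at hsucc
  change _ = _ + hilbertSamuel S (S ⊗[A] E) 1 at hsucc
  simpa only [hilbertSamuel_tensorProduct hS] using hsucc

theorem ker_inf_pow_smul_top_le (h : HasUlrichGrowth A E) {F : Type*} [AddCommGroup F] [Module A F]
    {ε : F →ₗ[A] E} (hε : Function.Surjective ε) (n : ℕ) :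
    LinearMap.ker ε ⊓ maximalIdeal A ^ (n + 1) • ⊤ ≤ maximalIdeal A ^ n • LinearMap.ker ε := by
  obtain ⟨S, _, _, _, _, hS, x, hx, hreg, hxS⟩ := h.exists_extension_smul_top_eq
  have hkerS := ker_baseChange_of_surjective (S := S) hε
  rintro m ⟨hm, hpow⟩
  rw [← one_tmul_mem_baseChange (S := S), baseChange_smul, Ideal.map_pow, hS, ← hkerS]
  refine inf_pow_smul_top_le hx (fun f hf => ?_) (fun f hf => ?_) n ⟨?_, ?_⟩
  · rw [LinearMap.mem_ker, map_smul] at hf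
    exact hreg.right_eq_zero_of_smul hf
  · have hεf : ε.baseChange S f ∈ (maximalIdeal S • ⊤ : Submodule S (S ⊗[A] E)) :=
      Submodule.smul_top_le_comap_smul_top _ (ε.baseChange S) hf
    rw [hxS] at hεf
    obtain ⟨e, -, he⟩ := hεf
    obtain ⟨g, rfl⟩ := LinearMap.baseChange_surjective S hε e
    refine Submodule.mem_sup.2 ⟨x • g, ⟨g, trivial, rfl⟩, f - x • g, ?_, add_sub_cancel _ _⟩
    rw [LinearMap.mem_ker, map_sub, map_smul, sub_eq_zero]
    exact he.symm
  · exact hkerS ▸ Submodule.tmul_mem_baseChange_of_mem _ hm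
  · rw [← hS, ← baseChange_pow_smul_top]
    exact Submodule.tmul_mem_baseChange_of_mem _ hpow

end HasUlrichGrowth

theorem exists_eventually_eq_of_monotone {D : ℕ → ℕ∞} (hD : Monotone D) {C : ℕ∞} (hC : C ≠ ⊤)
    (hDC : ∀ᶠ n in Filter.atTop, D n ≤ C) : ∃ e, ∀ᶠ n in Filter.atTop, D n = e := by
  obtain ⟨c, hc⟩ := Filter.eventually_atTop.1 hDC
  have hsup : ⨆ n, D n ≤ C :=
    iSup_le fun n => (hD (le_max_left n c)).trans (hc _ (le_max_right n c))
  obtain ⟨m, hm⟩ := ENat.exists_eq_iSup_of_lt_top (hsup.trans_lt hC.lt_top)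
  exact ⟨D m, Filter.eventually_atTop.2
    ⟨m, fun n hn => le_antisymm (hm ▸ le_iSup D n) (hD hn)⟩⟩

theorem exists_eventually_hilbertSamuel_succ {y : A} (hy : y ∈ maximalIdeal A)
    (hyE : IsSMulRegular E y) (hfin : Module.length A (QuotSMulTop y E) ≠ ⊤) :
    ∃ e : ℕ∞, ∀ᶠ n in Filter.atTop, hilbertSamuel A E (n + 1) = hilbertSamuel A E n + e := by
  obtain ⟨S, _, _, _, _, _, hS, _⟩ := exists_faithfullyFlat_infinite_residueField A
  obtain ⟨x, hx⟩ := exists_isSuperficial (A := S) (E := S ⊗[A] E)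
  let D : ℕ → ℕ∞ := fun n => Module.length S ((S ⊗[A] E) ⧸
    (x • ⊤ ⊔ maximalIdeal S ^ (n + 1) • ⊤ : Submodule S (S ⊗[A] E)))
  have hD : ∀ᶠ n in Filter.atTop, hilbertSamuel A E (n + 1) = hilbertSamuel A E n + D n := by
    have hreg : IsSMulRegular (S ⊗[A] E) x := hx.isSMulRegular
      (hS ▸ Ideal.mem_map_of_mem _ hy) (isSMulRegular_tensorProduct hyE)
    filter_upwards [hx.eventually_mem_of_smul_mem hreg] with n hn
    simpa only [hilbertSamuel_tensorProduct hS] using hilbertSamuel_succ hx.1 hn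
  have hmono : Monotone D := fun m n hmn => Module.length_le_of_surjective _
    (Submodule.factor_surjective (sup_le_sup le_rfl (pow_smul_top_antitone _ (by omega))))
  have hbound : ∀ᶠ n in Filter.atTop, D n ≤ Module.length A (QuotSMulTop y E) := by
    filter_upwards [hD] with n hn
    exact (ENat.add_le_add_iff_left (hilbertSamuel_ne_top n)).1
      (hn ▸ hilbertSamuel_succ_le hy hyE n)
  obtain ⟨e, he⟩ := exists_eventually_eq_of_monotone hmono hfin hbound
  exact ⟨e, by filter_upwards [hD, he] with n hn hen using hen ▸ hn⟩

end

end Ulrich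

section CohenMacaulayGrowth

open scoped Pointwise

section PowerOfRegularSequence

variable {R : Type*} [CommRing R] {E : Type*} [AddCommGroup E] [Module R E]

theorem length_quotSMulTop_pow {y : R} (hy : IsSMulRegular E y) (n : ℕ) :
    Module.length R (QuotSMulTop (y ^ n) E) = n * Module.length R (QuotSMulTop y E) := by
  induction n with
  | zero =>
    have : Subsingleton (QuotSMulTop (y ^ 0) E) := Submodule.Quotient.subsingleton_iff.2 (by simp)
    simp [Module.length_eq_zero]
  | succ n ih =>
    change Module.length R (E ⧸ (y ^ (n + 1) • ⊤ : Submodule R E)) = _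
    rw [pow_succ', mul_smul, length_quotient_smul hy, ih, Nat.cast_succ, add_one_mul]

theorem ofList_pow_le_ofList_map_pow (rs : List R) {n : ℕ} (hn : n ≠ 0) :
    Ideal.ofList rs ^ (n * (rs.length + 1)) ≤ Ideal.ofList (rs.map (· ^ n)) := by
  induction rs with
  | nil => simp [hn]
  | cons r rs ih =>
    rw [List.map_cons, Ideal.ofList_cons, Ideal.ofList_cons, ← Ideal.span_singleton_pow,
      List.length_cons, mul_add_one, add_comm]
    exact Ideal.sup_pow_add_le_pow_sup_pow.trans (sup_le_sup le_rfl ih)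

section LocalRing

variable [IsLocalRing R] [IsNoetherianRing R] [Module.Finite R E] {r : R} {rs : List R}

theorem isWeaklyRegular_and_isSMulRegular_of_cons (h : IsWeaklyRegular E (r :: rs))
    (hmem : ∀ a ∈ r :: rs, a ∈ maximalIdeal R) :
    IsWeaklyRegular E rs ∧ IsSMulRegular (E ⧸ (Ideal.ofList rs • ⊤ : Submodule R E)) r := by
  rw [← isWeaklyRegular_singleton_iff, ← isWeaklyRegular_append_iff]
  exact IsLocalRing.isWeaklyRegular_of_perm_of_subset_maximalIdeal h
    (List.perm_append_singleton r rs).symm hmem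

theorem isWeaklyRegular_pow_cons (h : IsWeaklyRegular E (r :: rs))
    (hmem : ∀ a ∈ r :: rs, a ∈ maximalIdeal R) {n : ℕ} (hn : n ≠ 0) :
    IsWeaklyRegular E (r ^ n :: rs) := by
  obtain ⟨hrs, hr⟩ := isWeaklyRegular_and_isSMulRegular_of_cons h hmem
  refine IsLocalRing.isWeaklyRegular_of_perm_of_subset_maximalIdeal (rs := rs ++ [r ^ n])
    ((isWeaklyRegular_append_iff ..).2 ⟨hrs, (isWeaklyRegular_singleton_iff ..).2 (hr.pow n)⟩)
    (List.perm_append_singleton _ rs) fun a ha => ?_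
  rcases List.mem_append.1 ha with ha | ha
  · exact hmem a (List.mem_cons_of_mem r ha)
  · rw [List.mem_singleton.1 ha]
    exact Ideal.pow_mem_of_mem _ (hmem r List.mem_cons_self) n (Nat.pos_of_ne_zero hn)

theorem length_quotient_ofList_map_pow (h : IsWeaklyRegular E rs)
    (hmem : ∀ a ∈ rs, a ∈ maximalIdeal R) {n : ℕ} (hn : n ≠ 0) :
    Module.length R (E ⧸ (Ideal.ofList (rs.map (· ^ n)) • ⊤ : Submodule R E)) =
      n ^ rs.length * Module.length R (E ⧸ (Ideal.ofList rs • ⊤ : Submodule R E)) := by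
  induction rs generalizing E with
  | nil => rw [List.map_nil, List.length_nil, pow_zero, one_mul]
  | cons r rs ih =>
    have hrs : IsWeaklyRegular (QuotSMulTop (r ^ n) E) rs :=
      ((isWeaklyRegular_cons_iff ..).1 (isWeaklyRegular_pow_cons h hmem hn)).2
    rw [List.map_cons,
      (Submodule.quotOfListConsSMulTopEquivQuotSMulTopInner E (r ^ n) _).length_eq,
      ih hrs fun a ha => hmem a (List.mem_cons_of_mem r ha),
      ← (Submodule.quotOfListConsSMulTopEquivQuotSMulTopInner E (r ^ n) rs).length_eq,
      (Submodule.quotOfListConsSMulTopEquivQuotSMulTopOuter E (r ^ n) rs).length_eq,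
      (Submodule.quotOfListConsSMulTopEquivQuotSMulTopOuter E r rs).length_eq,
      length_quotSMulTop_pow (isWeaklyRegular_and_isSMulRegular_of_cons h hmem).2,
      List.length_cons, pow_succ, mul_assoc]

end LocalRing

end PowerOfRegularSequence

section IsCohenMacaulayLocalRing

variable (R : Type*) [CommRing R] [IsCohenMacaulayLocalRing R]

theorem exists_isRegular_isArtinianRing_quotient {d : ℕ} (hd : ringKrullDim R = d) :
    ∃ rs : List R, IsRegular R rs ∧ (∀ r ∈ rs, r ∈ maximalIdeal R) ∧ rs.length = d ∧
      IsArtinianRing (R ⧸ Ideal.ofList rs) := by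
  have hdepth : depth (maximalIdeal R) R = d :=
    WithBot.coe_inj.1 (IsCohenMacaulayLocalRing.depth_eq.trans hd)
  obtain ⟨rs, hrs, hmem, hlen⟩ := exists_isWeaklyRegular_of_le_depth hdepth.ge
  have hreg := (IsLocalRing.isRegular_iff_isWeaklyRegular_of_subset_maximalIdeal hmem).2 hrs
  refine ⟨rs, hreg, hmem, hlen, isArtinianRing_iff_krullDimLE_zero.2 ?_⟩
  have hdim := ringKrullDim_add_length_eq_ringKrullDim_of_isRegular rs hreg
  rw [hd, hlen] at hdim
  exact Ring.krullDimLE_iff.2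
    (ENat.WithBot.add_natCast_cancel.1 (hdim.trans (zero_add _).symm)).le

theorem exists_hilbertSamuel_le {d : ℕ} (hd : ringKrullDim R = d) :
    ∃ C : ℕ, ∀ n ≠ 0, hilbertSamuel R R n ≤ (n ^ d * C : ℕ) := by
  obtain ⟨rs, hrs, hmem, rfl, _⟩ := exists_isRegular_isArtinianRing_quotient R hd
  obtain ⟨N, hN⟩ := exists_maximalIdeal_pow_le_of_isArtinianRing_quotient (Ideal.ofList rs)
  have hfin : Module.length R (R ⧸ (Ideal.ofList rs • ⊤ : Submodule R R)) ≠ ⊤ :=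
    ne_top_of_le_ne_top (hilbertSamuel_ne_top N) (Module.length_le_of_surjective _
      (Submodule.factor_surjective (Submodule.smul_mono_left hN)))
  obtain ⟨C, hC⟩ := ENat.ne_top_iff_exists.1 hfin
  refine ⟨C, fun n hn => ?_⟩
  have hle : Ideal.ofList (rs.map (· ^ n)) ≤ maximalIdeal R ^ n := by
    refine Ideal.span_le.2 fun a ha => ?_
    obtain ⟨r, hr, rfl⟩ := List.mem_map.1 ha
    exact Ideal.pow_mem_pow (hmem r hr) n
  refine (Module.length_le_of_surjective _ (Submodule.factor_surjective
    (Submodule.smul_mono_left hle))).trans_eq ?_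
  rw [length_quotient_ofList_map_pow hrs.toIsWeaklyRegular hmem hn, ← hC]
  norm_cast

theorem exists_le_hilbertSamuel {d : ℕ} (hd : ringKrullDim R = d) :
    ∃ N ≠ 0, ∀ n ≠ 0, (n ^ d : ℕ) ≤ hilbertSamuel R R (N * n) := by
  obtain ⟨rs, hrs, hmem, rfl, _⟩ := exists_isRegular_isArtinianRing_quotient R hd
  obtain ⟨N, hN⟩ := exists_maximalIdeal_pow_le_of_isArtinianRing_quotient (Ideal.ofList rs)
  have : Nontrivial (R ⧸ (Ideal.ofList rs • ⊤ : Submodule R R)) :=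
    Submodule.Quotient.nontrivial_iff.2 hrs.top_ne_smul.symm
  refine ⟨(N + 1) * (rs.length + 1), by positivity, fun n hn => ?_⟩
  have hle : maximalIdeal R ^ ((N + 1) * (rs.length + 1) * n) ≤
      Ideal.ofList (rs.map (· ^ n)) := by
    rw [mul_assoc, mul_comm (_ + 1) n, pow_mul]
    exact (Ideal.pow_right_mono ((Ideal.pow_le_pow_right N.le_succ).trans hN) _).trans
      (ofList_pow_le_ofList_map_pow rs hn)
  refine le_trans ?_ (Module.length_le_of_surjective _ (Submodule.factor_surjective
    (Submodule.smul_mono_left hle)))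
  rw [length_quotient_ofList_map_pow hrs.toIsWeaklyRegular hmem hn, Nat.cast_pow]
  exact le_mul_of_one_le_right' (Order.one_le_iff_pos.2 Module.length_pos)

theorem exists_ringKrullDim_eq_natCast : ∃ d : ℕ, ringKrullDim R = d := by
  obtain ⟨d, hd⟩ := WithBot.ne_bot_iff_exists.1 (ringKrullDim_ne_bot (R := R))
  obtain ⟨d, rfl⟩ := ENat.ne_top_iff_exists.1 fun h : d = ⊤ =>
    ringKrullDim_ne_top (R := R) (hd ▸ congrArg _ h)
  exact ⟨d, hd.symm⟩

variable {R} {S : Type*} [CommRing S] [IsCohenMacaulayLocalRing S]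

theorem ringKrullDim_le_of_hilbertSamuel_eq
    (h : ∀ n, hilbertSamuel R R n = hilbertSamuel S S n) : ringKrullDim R ≤ ringKrullDim S := by
  obtain ⟨d, hd⟩ := exists_ringKrullDim_eq_natCast R
  obtain ⟨e, he⟩ := exists_ringKrullDim_eq_natCast S
  obtain ⟨N, hN, hlow⟩ := exists_le_hilbertSamuel R hd
  obtain ⟨C, hup⟩ := exists_hilbertSamuel_le S he
  rw [hd, he, Nat.cast_le]
  by_contra! hlt
  let K := N ^ e * C
  have hK : (K + 1) ^ d ≤ (N * (K + 1)) ^ e * C := by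
    have hbound := (hlow (K + 1) K.succ_ne_zero).trans
      ((h _).trans_le (hup _ (mul_ne_zero hN K.succ_ne_zero)))
    exact_mod_cast hbound
  refine hK.not_gt ?_
  calc (N * (K + 1)) ^ e * C = K * (K + 1) ^ e := by rw [mul_pow, mul_right_comm]
    _ < (K + 1) * (K + 1) ^ e := by gcongr; omega
    _ = (K + 1) ^ (e + 1) := (pow_succ' _ _).symm
    _ ≤ (K + 1) ^ d := Nat.pow_le_pow_right K.succ_pos hlt

theorem ringKrullDim_eq_of_hilbertSamuel_eq
    (h : ∀ n, hilbertSamuel R R n = hilbertSamuel S S n) : ringKrullDim R = ringKrullDim S :=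
  le_antisymm (ringKrullDim_le_of_hilbertSamuel_eq h)
    (ringKrullDim_le_of_hilbertSamuel_eq fun n => (h n).symm)

end IsCohenMacaulayLocalRing

end CohenMacaulayGrowth

section LocalizationAtIrrelevant

variable {A : Type u} [CommRing A] [IsLocalRing A]

namespace AssocGradedRing

theorem exists_sub_algebraMap_mem_irrelevant (u : AssocGradedRing A) :
    ∃ a : A, u - algebraMap A _ a ∈ irrelevant A := by
  obtain ⟨r, rfl⟩ := mk_surjective u
  refine ⟨r.coeff 0, ?_⟩
  rw [← mk.commutes, ← map_sub, mk_mem_irrelevant, Algebra.algebraMap_eq_smul_one]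
  simp [Rees.coeff_one]

instance : (irrelevant A).IsMaximal := by
  refine Ideal.isMaximal_iff.2 ⟨fun h => ?_, fun J u hJ hu huJ => ?_⟩
  · have hone := mk_mem_irrelevant.1 (map_one (mk (A := A)) ▸ h)
    rw [Rees.coeff_one, if_pos rfl] at hone
    exact Ideal.one_notMem _ hone
  · obtain ⟨a, ha⟩ := exists_sub_algebraMap_mem_irrelevant u
    have haJ : algebraMap A _ a ∈ J := (Submodule.sub_mem_iff_right _ huJ).1 (hJ ha)
    have hunit : IsUnit a := by
      refine notMem_maximalIdeal.1 fun hmem => hu ?_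
      have ha' : algebraMap A _ a ∈ irrelevant A := by
        rw [← mk.commutes, mk_mem_irrelevant, Algebra.algebraMap_eq_smul_one]
        simpa [Rees.coeff_one] using hmem
      exact (Submodule.sub_mem_iff_left _ ha').1 ha
    exact (Ideal.eq_top_of_isUnit_mem _ haJ (hunit.map _)) ▸ trivial

theorem initialForm_mem_irrelevant_pow_succ {n : ℕ} {a : ↥(maximalIdeal A ^ n)} :
    initialForm n a ∈ irrelevant A ^ (n + 1) ↔ (a : A) ∈ maximalIdeal A ^ (n + 1) := by
  refine mk_mem_irrelevant_pow.trans ⟨fun h => ?_, fun h j _ => ?_⟩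
  · simpa [Rees.coeff_monomial] using h n n.lt_succ_self
  · exact mk_eq_zero.1 (initialForm_eq_zero.2 h) j

theorem range_initialForm_sup_irrelevant_pow_succ (n : ℕ) :
    LinearMap.range (initialForm (A := A) n) ⊔ (irrelevant A ^ (n + 1)).restrictScalars A =
      (irrelevant A ^ n).restrictScalars A := by
  refine le_antisymm (sup_le ?_ (Ideal.pow_le_pow_right n.le_succ)) fun u hu => ?_
  · rintro _ ⟨a, rfl⟩
    exact initialForm_mem_irrelevant_pow a
  · obtain ⟨r, rfl⟩ := mk_surjective u
    let a : ↥(maximalIdeal A ^ n) := ⟨r.coeff n, r.coeff_mem n⟩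
    refine Submodule.mem_sup.2 ⟨initialForm n a, ⟨a, rfl⟩, mk (r - Rees.monomial n a), ?_, ?_⟩
    · refine mk_mem_irrelevant_pow.2 fun j hj => ?_
      rw [map_sub, Rees.coeff_monomial]
      split_ifs with hnj
      · subst hnj
        exact sub_self (r.coeff n) ▸ zero_mem _
      · rw [sub_zero]
        exact mk_mem_irrelevant_pow.1 hu j (by omega)
    · exact (map_sub mk r _).symm ▸ add_sub_cancel (initialForm n a) (mk r)

theorem length_quotient_irrelevant_pow (n : ℕ) :
    Module.length A (AssocGradedRing A ⧸ irrelevant A ^ n) =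
      Module.length A (A ⧸ maximalIdeal A ^ n) := by
  induction n with
  | zero => simp [Module.length_eq_zero]
  | succ n ih =>
    have hcomap : ((irrelevant A ^ (n + 1)).restrictScalars A).comap (initialForm n) =
        Submodule.comap (maximalIdeal A ^ n).subtype (maximalIdeal A ^ (n + 1)) :=
      Submodule.ext fun _ => initialForm_mem_irrelevant_pow_succ
    have hsup : (maximalIdeal A ^ n) ⊔ maximalIdeal A ^ (n + 1) = maximalIdeal A ^ n :=
      sup_eq_left.2 (Ideal.pow_le_pow_right n.le_succ)
    have hgraded := length_quotient_eq_length_quotient_comap_add (initialForm n)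
      ((irrelevant A ^ (n + 1)).restrictScalars A)
    have hlocal := length_quotient_eq_length_quotient_comap_add (maximalIdeal A ^ n).subtype
      (maximalIdeal A ^ (n + 1))
    rw [hcomap, range_initialForm_sup_irrelevant_pow_succ] at hgraded
    rw [Submodule.range_subtype, hsup, ← ih] at hlocal
    exact hgraded.trans hlocal.symm

end AssocGradedRing

variable (A)

/-- The localization of the associated graded ring at its homogeneous maximal ideal. -/
abbrev LocalizedAssocGradedRing : Type u := Localization.AtPrime (irrelevant A)

namespace LocalizedAssocGradedRing

instance : IsLocalHom (algebraMap A (LocalizedAssocGradedRing A)) := by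
  refine ((local_hom_TFAE _).out 0 2).2 (Ideal.map_le_iff_le_comap.2 fun a ha => ?_)
  rw [Ideal.mem_comap, IsScalarTower.algebraMap_apply A (AssocGradedRing A),
    IsLocalization.AtPrime.to_map_mem_maximal_iff _ (irrelevant A), ← AssocGradedRing.mk.commutes,
    AssocGradedRing.mk_mem_irrelevant, Algebra.algebraMap_eq_smul_one]
  simpa [Rees.coeff_one] using ha

theorem length_quotient_maximalIdeal_pow (n : ℕ) :
    Module.length A (LocalizedAssocGradedRing A ⧸ maximalIdeal (LocalizedAssocGradedRing A) ^ n) =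
      Module.length A (A ⧸ maximalIdeal A ^ n) :=
  ((IsLocalization.AtPrime.equivQuotMaximalIdealPow (irrelevant A)
    (LocalizedAssocGradedRing A) n).toLinearEquiv.restrictScalars A).length_eq.symm.trans
    (AssocGradedRing.length_quotient_irrelevant_pow n)

theorem length_residueField :
    Module.length (ResidueField A) (ResidueField (LocalizedAssocGradedRing A)) = 1 := by
  have hsimple (R : Type u) [CommRing R] [IsLocalRing R] :
      Module.length R (R ⧸ maximalIdeal R) = 1 :=
    Module.length_eq_one_iff.2
      (isSimpleModule_iff_quot_maximal.2 ⟨_, inferInstance, ⟨LinearEquiv.refl _ _⟩⟩)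
  have hone := length_quotient_maximalIdeal_pow A 1
  rw [pow_one, pow_one, hsimple, IsLocalRing.length_restrictScalars A (LocalizedAssocGradedRing A),
    hsimple, one_mul] at hone
  exact hone

theorem hilbertSamuel_eq (n : ℕ) :
    hilbertSamuel (LocalizedAssocGradedRing A) (LocalizedAssocGradedRing A) n =
      hilbertSamuel A A n := by
  have h := IsLocalRing.length_restrictScalars A (LocalizedAssocGradedRing A)
    (LocalizedAssocGradedRing A ⧸ maximalIdeal (LocalizedAssocGradedRing A) ^ n)
  rw [length_residueField, mul_one, length_quotient_maximalIdeal_pow] at h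
  rw [hilbertSamuel, hilbertSamuel, smul_eq_mul, smul_eq_mul, Ideal.mul_top, Ideal.mul_top, h]

theorem depth_irrelevant_le :
    depth (irrelevant A) (AssocGradedRing A) ≤
      depth (maximalIdeal (LocalizedAssocGradedRing A)) (LocalizedAssocGradedRing A) := by
  refine iSup₂_le fun rs hrs => iSup_le fun hmem => ?_
  rw [← List.length_map (algebraMap (AssocGradedRing A) (LocalizedAssocGradedRing A))]
  refine le_depth_of_isRegular
    (hrs.1.isRegular_of_isLocalization_of_mem _ (irrelevant A) hmem) fun r hr => ?_
  obtain ⟨g, hg, rfl⟩ := List.mem_map.1 hr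
  exact (IsLocalization.AtPrime.to_map_mem_maximal_iff _ (irrelevant A) g).2 (hmem g hg)

variable {A} in
theorem isCohenMacaulayLocalRing_and_ringKrullDim_eq [IsNoetherianRing A]
    (hG : IsGradedCohenMacaulay A (AssocGradedRing A)) :
    IsCohenMacaulayLocalRing (LocalizedAssocGradedRing A) ∧
      ringKrullDim (LocalizedAssocGradedRing A) = ringKrullDim (AssocGradedRing A) := by
  rw [IsGradedCohenMacaulay, Module.supportDim_self_eq_ringKrullDim] at hG
  have hle : ringKrullDim (LocalizedAssocGradedRing A) ≤ ringKrullDim (AssocGradedRing A) :=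
    (IsLocalization.AtPrime.ringKrullDim_eq_height (irrelevant A) _).trans_le
      (Ideal.height_le_ringKrullDim_of_ne_top Ideal.IsPrime.ne_top')
  have hdepth := depth_le_supportDim (N := LocalizedAssocGradedRing A)
    (maximalIdeal (LocalizedAssocGradedRing A))
  rw [Module.supportDim_self_eq_ringKrullDim] at hdepth
  have hge := hG.symm.trans_le (WithBot.coe_le_coe.2 (depth_irrelevant_le A))
  exact ⟨{ depth_eq := le_antisymm hdepth (hle.trans hge) }, le_antisymm hle (hge.trans hdepth)⟩

end LocalizedAssocGradedRing

end LocalizationAtIrrelevant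

theorem IsGradedCohenMacaulay.ringKrullDim_eq {A : Type u} [CommRing A]
    [IsCohenMacaulayLocalRing A]
    (hG : IsGradedCohenMacaulay A (AssocGradedRing A)) :
    ringKrullDim (AssocGradedRing A) = ringKrullDim A := by
  obtain ⟨_, hdim⟩ := LocalizedAssocGradedRing.isCohenMacaulayLocalRing_and_ringKrullDim_eq hG
  exact hdim.symm.trans
    (ringKrullDim_eq_of_hilbertSamuel_eq (LocalizedAssocGradedRing.hilbertSamuel_eq A))

section GradedSyzygy

variable {A : Type u} [CommRing A] [IsLocalRing A]

theorem mem_smul_top_pi_iff {R σ : Type*} [CommRing R] [Finite σ] {I : Ideal R} {u : σ → R} :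
    u ∈ (I • ⊤ : Submodule R (σ → R)) ↔ ∀ i, u i ∈ I := by
  classical
  have := Fintype.ofFinite σ
  refine ⟨fun hu i => ?_, fun hu => pi_eq_sum_univ u ▸
    Submodule.sum_mem _ fun i _ => Submodule.smul_mem_smul (hu i) trivial⟩
  have hle : (I • ⊤ : Submodule R (σ → R)).map (LinearMap.proj i) ≤ I • ⊤ :=
    (Submodule.map_smul'' I ⊤ _).trans_le (smul_mono_right I le_top)
  simpa using hle (Submodule.mem_map_of_mem hu)

theorem Rees.eventually_coeff_eq_zero (r : Rees A) : ∀ᶠ n in Filter.atTop, r.coeff n = 0 := by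
  let p : Polynomial A := (r : reesAlgebra (maximalIdeal A)).1
  filter_upwards [Filter.eventually_gt_atTop p.natDegree] with n hn
  exact Polynomial.coeff_eq_zero_of_natDegree_lt hn

variable {M : Type u} [AddCommGroup M] [Module A M]

section Shift

theorem apply_mem_pow_succ {φ : M →ₗ[A] A} (hφ : LinearMap.range φ ≤ maximalIdeal A) {n : ℕ}
    {m : M} (hm : m ∈ (maximalIdeal A ^ n • ⊤ : Submodule A M)) :
    φ m ∈ maximalIdeal A ^ (n + 1) := by
  have hle : (maximalIdeal A ^ n • ⊤ : Submodule A M).map φ ≤ maximalIdeal A ^ (n + 1) :=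
    (Submodule.map_smul'' _ ⊤ φ).trans_le
      (pow_succ (maximalIdeal A) n ▸ smul_mono_right _ ((Submodule.map_top φ).trans_le hφ))
  exact hle (Submodule.mem_map_of_mem hm)

variable (φ : M →ₗ[A] A) (hφ : LinearMap.range φ ≤ maximalIdeal A)

/-- The degree-one map `⨁ 𝔪 ^ n M t ^ n → ⨁ 𝔪 ^ n t ^ n` induced by a linear form on `M` with
values in `𝔪`. -/
def ReesModule.shift : ReesModule A M →ₗ[Rees A] Rees A where
  toFun p :=
    let q : ((maximalIdeal A).stableFiltration (⊤ : Submodule A M)).submodule := p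
    (⟨Polynomial.X * PolynomialModule.equivPolynomialSelf (PolynomialModule.map A φ q.1), by
      rintro (_ | n)
      · simp
      · rw [Polynomial.coeff_X_mul]
        exact apply_mem_pow_succ hφ (q.2 n)⟩ : reesAlgebra (maximalIdeal A))
  map_add' p q := Subtype.ext <| by
    let p' : ((maximalIdeal A).stableFiltration (⊤ : Submodule A M)).submodule := p
    let q' : ((maximalIdeal A).stableFiltration (⊤ : Submodule A M)).submodule := q
    change Polynomial.X * PolynomialModule.equivPolynomialSelf
      (PolynomialModule.map A φ (p'.1 + q'.1)) = _
    rw [map_add, map_add, mul_add]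
    rfl
  map_smul' r p := Subtype.ext <| by
    let f : Polynomial A := (r : reesAlgebra (maximalIdeal A)).1
    let q : ((maximalIdeal A).stableFiltration (⊤ : Submodule A M)).submodule := p
    change Polynomial.X *
        PolynomialModule.equivPolynomialSelf (PolynomialModule.map A φ (f • q.1)) =
      f * (Polynomial.X * PolynomialModule.equivPolynomialSelf (PolynomialModule.map A φ q.1))
    rw [PolynomialModule.map_smul, Algebra.algebraMap_self, Polynomial.map_id, map_smul,
      smul_eq_mul, mul_left_comm]

theorem ReesModule.coeff_zero_shift (p : ReesModule A M) : (shift φ hφ p).coeff 0 = 0 :=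
  Polynomial.coeff_X_mul_zero _

theorem ReesModule.coeff_succ_shift (n : ℕ) (p : ReesModule A M) :
    (shift φ hφ p).coeff (n + 1) = φ (p.coeff n) :=
  Polynomial.coeff_X_mul _ n

/-- The degree-one map `G(M) → G(A)` induced by a linear form on `M` with values in `𝔪`. -/
def AssocGraded.shift : AssocGraded A M →ₗ[AssocGradedRing A] AssocGradedRing A :=
  let shiftRees : AssocGraded A M →ₗ[Rees A] AssocGradedRing A :=
    Submodule.liftQ _ (Algebra.linearMap (Rees A) (AssocGradedRing A) ∘ₗ ReesModule.shift φ hφ)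
      fun p hp => AssocGradedRing.mk_eq_zero.2 fun n => by
        rcases n with _ | n
        · exact ReesModule.coeff_zero_shift φ hφ p ▸ zero_mem _
        · exact ReesModule.coeff_succ_shift φ hφ n p ▸
            apply_mem_pow_succ hφ (mem_reesMaximal_smul_top.1 hp n)
  shiftRees.extendScalarsOfSurjective Ideal.Quotient.mk_surjective

variable {σ : Type*} [Finite σ] {ι : M →ₗ[A] σ → A}

theorem range_proj_comp_le (hι : LinearMap.range ι ≤ maximalIdeal A • ⊤) (i : σ) :
    LinearMap.range (LinearMap.proj i ∘ₗ ι) ≤ maximalIdeal A := by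
  rintro _ ⟨m, rfl⟩
  exact mem_smul_top_pi_iff.1 (hι (LinearMap.mem_range_self ι m)) i

/-- The degree-one map `G(M) → G(F)` induced by a map `M → 𝔪 F` to the free module `F` with
basis `σ`; the target is identified with the free module with basis `σ` over `G(A)`. -/
def AssocGraded.shiftPi (hι : LinearMap.range ι ≤ maximalIdeal A • ⊤) :
    AssocGraded A M →ₗ[AssocGradedRing A] σ → AssocGradedRing A :=
  LinearMap.pi fun i => shift (LinearMap.proj i ∘ₗ ι) (range_proj_comp_le hι i)

theorem AssocGraded.shiftPi_mk (hι : LinearMap.range ι ≤ maximalIdeal A • ⊤) (p : ReesModule A M) :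
    shiftPi hι (mk p) = fun i => AssocGradedRing.mk (ReesModule.shift (LinearMap.proj i ∘ₗ ι)
      (range_proj_comp_le hι i) p) := rfl

theorem AssocGraded.shiftPi_injective (hι : LinearMap.range ι ≤ maximalIdeal A • ⊤)
    (hpow : ∀ n, (maximalIdeal A ^ (n + 1) • ⊤ : Submodule A (σ → A)).comap ι ≤
      maximalIdeal A ^ n • ⊤) : Function.Injective (shiftPi hι) := by
  refine (injective_iff_map_eq_zero _).2 fun z hz => ?_
  obtain ⟨p, rfl⟩ := mk_surjective z
  refine mk_eq_zero.2 fun n => hpow (n + 1) (mem_smul_top_pi_iff.2 fun i => ?_)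
  rw [shiftPi_mk] at hz
  have hcoeff := AssocGradedRing.mk_eq_zero.1 (congrFun hz i) (n + 1)
  rwa [ReesModule.coeff_succ_shift] at hcoeff

end Shift

section Cover

variable {E : Type u} [AddCommGroup E] [Module A E] {σ : Type*} [Fintype σ]

/-- The map `⨁ 𝔪 ^ n F t ^ n → ⨁ 𝔪 ^ n E t ^ n` induced by a map `F → E` from the free module
`F` with basis `σ`; the source is identified with the free module with basis `σ` over the Rees
algebra. -/
def ReesModule.cover (ε : (σ → A) →ₗ[A] E) : (σ → Rees A) →ₗ[Rees A] ReesModule A E :=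
  open Classical in
  Fintype.linearCombination (Rees A) fun i => single 0 ⟨ε (Pi.single i 1), by simp⟩

/-- The map `G(F) → G(E)` induced by a map `F → E` from the free module `F` with basis `σ`; the
source is identified with the free module with basis `σ` over `G(A)`. -/
def AssocGraded.cover (ε : (σ → A) →ₗ[A] E) :
    (σ → AssocGradedRing A) →ₗ[AssocGradedRing A] AssocGraded A E :=
  open Classical in
  Fintype.linearCombination (AssocGradedRing A) fun i =>
    mk (ReesModule.single 0 ⟨ε (Pi.single i 1), by simp⟩)

theorem ReesModule.coeff_smul_single_zero (n : ℕ) (r : Rees A)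
    (u : (maximalIdeal A ^ 0 • ⊤ : Submodule A E)) :
    (r • single 0 u).coeff n = r.coeff n • (u : E) := by
  rw [coeff_smul, Finset.sum_eq_single (n, 0)]
  · simp only [coeff_single, if_true]
  · rintro ⟨k, l⟩ hkl hne
    have hl : 0 ≠ l := by
      rintro rfl
      exact hne (by simpa using hkl)
    rw [coeff_single, if_neg hl, smul_zero]
  · simp

theorem ReesModule.coeff_cover (ε : (σ → A) →ₗ[A] E) (n : ℕ) (r : σ → Rees A) :
    (cover ε r).coeff n = ε fun i => (r i).coeff n := by
  classical
  rw [pi_eq_sum_univ' fun i => (r i).coeff n]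
  simp only [cover, Fintype.linearCombination_apply, map_sum, coeff_smul_single_zero, map_smul]

theorem AssocGraded.cover_mk (ε : (σ → A) →ₗ[A] E) (r : σ → Rees A) :
    (cover ε fun i => AssocGradedRing.mk (r i)) = mk (ReesModule.cover ε r) := by
  simp only [cover, ReesModule.cover, Fintype.linearCombination_apply, mk_smul_mk, map_sum]

theorem AssocGraded.cover_mk_eq_zero {ε : (σ → A) →ₗ[A] E} {r : σ → Rees A} :
    (cover ε fun i => AssocGradedRing.mk (r i)) = 0 ↔
      ∀ n, (ε fun i => (r i).coeff n) ∈ (maximalIdeal A ^ (n + 1) • ⊤ : Submodule A E) := by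
  simp only [cover_mk, mk_eq_zero, ReesModule.coeff_cover]

end Cover

theorem exists_sub_apply_mem_smul_top {R L F N : Type*} [CommRing R] [AddCommGroup L] [Module R L]
    [AddCommGroup F] [Module R F] [AddCommGroup N] [Module R N] {ι : L →ₗ[R] F} {ε : F →ₗ[R] N}
    (hex : Function.Exact ι ε) (hε : Function.Surjective ε) {J : Ideal R} {u : F}
    (hu : ε u ∈ (J • ⊤ : Submodule R N)) : ∃ m, u - ι m ∈ (J • ⊤ : Submodule R F) := by
  have hmap : (J • ⊤ : Submodule R F).map ε = J • ⊤ := by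
    rw [Submodule.map_smul'', Submodule.map_top, LinearMap.range_eq_top.2 hε]
  obtain ⟨v, hv, hvu⟩ := hmap ▸ hu
  obtain ⟨m, hm⟩ := (hex (u - v)).1 (by rw [map_sub, hvu, sub_self])
  exact ⟨m, by rwa [hm, sub_sub_cancel]⟩

section Syzygy

variable {E : Type u} [AddCommGroup E] [Module A E] {σ : Type*} [Fintype σ]
  {ι : M →ₗ[A] σ → A} {ε : (σ → A) →ₗ[A] E}

theorem AssocGraded.cover_shiftPi_mk (hι : LinearMap.range ι ≤ maximalIdeal A • ⊤)
    (hex : Function.Exact ι ε) (p : ReesModule A M) : cover ε (shiftPi hι (mk p)) = 0 := by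
  rw [shiftPi_mk, cover_mk_eq_zero]
  intro n
  rcases n with _ | n
  · simp only [ReesModule.coeff_zero_shift]
    exact (map_zero ε).symm ▸ zero_mem _
  · simp only [ReesModule.coeff_succ_shift]
    exact (hex.apply_apply_eq_zero (p.coeff n)).symm ▸ zero_mem _

theorem AssocGraded.exists_shiftPi_eq (hι : LinearMap.range ι ≤ maximalIdeal A • ⊤)
    (hpow : ∀ n, (maximalIdeal A ^ (n + 1) • ⊤ : Submodule A (σ → A)).comap ι ≤
      maximalIdeal A ^ n • ⊤) (hex : Function.Exact ι ε) (hε : Function.Surjective ε)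
    {r : σ → Rees A} (hr : cover ε (fun i => AssocGradedRing.mk (r i)) = 0) :
    ∃ z, shiftPi hι z = fun i => AssocGradedRing.mk (r i) := by
  have hcoeff := cover_mk_eq_zero.1 hr
  choose m hm using fun n => exists_sub_apply_mem_smul_top hex hε (hcoeff (n + 1))
  have hm_mem (n) : m n ∈ (maximalIdeal A ^ n • ⊤ : Submodule A M) := hpow n <| by
    have hr_mem : (fun i => (r i).coeff (n + 1)) ∈
        (maximalIdeal A ^ (n + 1) • ⊤ : Submodule A (σ → A)) :=
      mem_smul_top_pi_iff.2 fun i => (r i).coeff_mem (n + 1)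
    simpa using sub_mem hr_mem (pow_smul_top_antitone _ (Nat.le_succ (n + 1)) (hm n))
  obtain ⟨D, hD⟩ := Filter.eventually_atTop.1
    (Filter.eventually_all.2 fun i => (r i).eventually_coeff_eq_zero)
  let p : ReesModule A M := ∑ n ∈ Finset.range D, ReesModule.single n ⟨m n, hm_mem n⟩
  refine ⟨mk p, shiftPi_mk hι p ▸ funext fun i => sub_eq_zero.1 ?_⟩
  rw [← map_sub, AssocGradedRing.mk_eq_zero]
  intro n
  rw [map_sub]
  rcases n with _ | n
  · rw [ReesModule.coeff_zero_shift, zero_sub, neg_mem_iff]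
    obtain ⟨m₀, hm₀⟩ := exists_sub_apply_mem_smul_top hex hε (hcoeff 0)
    have hιm₀ : ι m₀ ∈ (maximalIdeal A ^ (0 + 1) • ⊤ : Submodule A (σ → A)) := by
      simpa using hι (LinearMap.mem_range_self ι m₀)
    exact mem_smul_top_pi_iff.1 ((Submodule.sub_mem_iff_left _ hιm₀).1 hm₀) i
  · rw [ReesModule.coeff_succ_shift]
    simp only [p, map_sum, ReesModule.coeff_single, Finset.sum_ite_eq', Finset.mem_range]
    split_ifs with hn
    · exact sub_mem_comm_iff.1 (mem_smul_top_pi_iff.1 (hm n) i)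
    · rw [hD (n + 1) (by omega) i]
      simp

theorem AssocGraded.exact_shiftPi_cover (hι : LinearMap.range ι ≤ maximalIdeal A • ⊤)
    (hpow : ∀ n, (maximalIdeal A ^ (n + 1) • ⊤ : Submodule A (σ → A)).comap ι ≤
      maximalIdeal A ^ n • ⊤) (hex : Function.Exact ι ε) (hε : Function.Surjective ε) :
    Function.Exact (shiftPi hι) (cover ε) := by
  refine fun x => ⟨fun hx => ?_, ?_⟩
  · choose r hr using fun i => AssocGradedRing.mk_surjective (x i)
    obtain rfl : (fun i => AssocGradedRing.mk (r i)) = x := funext hr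
    exact exists_shiftPi_eq hι hpow hex hε hx
  · rintro ⟨z, rfl⟩
    obtain ⟨p, rfl⟩ := mk_surjective z
    exact cover_shiftPi_mk hι hex p

end Syzygy

section Regularity

theorem AssocGraded.coeff_zero_mem_of_mk_mem {p : ReesModule A M}
    (hp : mk p ∈ (irrelevant A • ⊤ : Submodule (AssocGradedRing A) (AssocGraded A M))) :
    p.coeff 0 ∈ (maximalIdeal A • ⊤ : Submodule A M) := by
  obtain ⟨q, hq, hqp⟩ :
      ∃ q : ReesModule A M, q.coeff 0 ∈ (maximalIdeal A • ⊤ : Submodule A M) ∧ mk q = mk p := by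
    refine Submodule.smul_induction_on hp (fun r hr z _ => ?_) ?_
    · obtain ⟨r, rfl⟩ := AssocGradedRing.mk_surjective r
      obtain ⟨q, rfl⟩ := mk_surjective z
      refine ⟨r • q, ?_, (mk_smul_mk r q).symm⟩
      simpa [ReesModule.coeff_smul] using
        Submodule.smul_mem_smul (AssocGradedRing.mk_mem_irrelevant.1 hr) Submodule.mem_top
    · rintro _ _ ⟨q, hq, rfl⟩ ⟨q', hq', rfl⟩
      exact ⟨q + q', map_add (ReesModule.coeff 0) q q' ▸ add_mem hq hq', map_add mk q q'⟩
  have hsub := mk_eq_zero.1 ((map_sub mk p q).trans (sub_eq_zero.2 hqp.symm)) 0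
  rw [map_sub, zero_add, pow_one] at hsub
  exact (Submodule.sub_mem_iff_left _ hq).1 hsub

theorem AssocGraded.irrelevant_smul_top_ne_top [Module.Finite A M] [Nontrivial M] :
    (irrelevant A • ⊤ : Submodule (AssocGradedRing A) (AssocGraded A M)) ≠ ⊤ := by
  intro h
  refine Submodule.top_ne_ideal_smul_of_le_jacobson_annihilator (R := A) (M := M)
    (IsLocalRing.maximalIdeal_le_jacobson _) (top_le_iff.1 fun m _ => ?_).symm
  let p : ReesModule A M := ReesModule.single 0 ⟨m, by simp⟩
  have hp : p.coeff 0 ∈ (maximalIdeal A • ⊤ : Submodule A M) :=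
    coeff_zero_mem_of_mk_mem (h.ge Submodule.mem_top)
  simpa [p, ReesModule.coeff_single] using hp

theorem AssocGraded.eq_zero_of_forall_irrelevant_smul_eq_zero [IsNoetherianRing A]
    [Module.Finite A M] (hA : HasUlrichGrowth A M) {z : AssocGraded A M}
    (hz : ∀ r ∈ irrelevant A, r • z = 0) : z = 0 := by
  obtain ⟨p, rfl⟩ := mk_surjective z
  refine mk_eq_zero.2 fun n => hA.mem_pow_smul_top_of_forall_smul_mem fun a ha => ?_
  let a' : ↥(maximalIdeal A ^ 1) := ⟨a, (pow_one (maximalIdeal A)).symm ▸ ha⟩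
  have hap : mk (Rees.monomial 1 a' • p) = 0 := hz (AssocGradedRing.mk (Rees.monomial 1 a'))
    (AssocGradedRing.mk_mem_irrelevant.2 (by simp [Rees.coeff_monomial]))
  simpa [ReesModule.coeff_monomial_smul, a'] using mk_eq_zero.1 hap (n + 1)

theorem isWeaklyRegular_of_flat {R : Type*} [CommRing R] {rs : List R} (h : IsWeaklyRegular R rs)
    (N : Type*) [AddCommGroup N] [Module R N] [Module.Flat R N] : IsWeaklyRegular N rs :=
  ((TensorProduct.rid R N).isWeaklyRegular_congr rs).1 h.isWeaklyRegular_lTensor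

end Regularity

end GradedSyzygy

section HilbertSamuelValues

theorem hilbertSamuel_congr {A : Type*} [CommRing A] [IsLocalRing A] {E E' : Type*}
    [AddCommGroup E] [Module A E] [AddCommGroup E'] [Module A E'] (e : E ≃ₗ[A] E') (n : ℕ) :
    hilbertSamuel A E n = hilbertSamuel A E' n :=
  (Submodule.Quotient.equiv _ _ e (by
    rw [Submodule.map_smul'', Submodule.map_top,
      LinearMap.range_eq_top.2 e.surjective])).length_eq

theorem hilbertSamuel_eq_of_surjective {A B : Type*} [CommRing A] [IsLocalRing A] [CommRing B]
    [IsLocalRing B] [Algebra A B] (h : Function.Surjective (algebraMap A B)) {E : Type*}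
    [AddCommGroup E] [Module A E] [Module B E] [IsScalarTower A B E] (n : ℕ) :
    hilbertSamuel A E n = hilbertSamuel B E n := by
  have hpow : (maximalIdeal A ^ n • ⊤ : Submodule A E) =
      (maximalIdeal B ^ n • ⊤ : Submodule B E).restrictScalars A := by
    rw [← map_maximalIdeal_of_surjective _ h, ← Ideal.map_pow, Ideal.smul_restrictScalars,
      Submodule.restrictScalars_top]
  rw [hilbertSamuel, hilbertSamuel, hpow, (Submodule.Quotient.restrictScalarsEquiv A _).length_eq,
    Module.length_eq_of_surjective h]

variable {A : Type*} [CommRing A] [IsLocalRing A] {E : Type*} [AddCommGroup E] [Module A E]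

theorem hilbertSamuel_coe_one {N : Submodule A E} (hN : N.FG) :
    hilbertSamuel A N 1 = N.spanFinrank := by
  have : Module.Finite A N := Module.Finite.iff_fg.2 hN
  rw [IsLocalRing.spanFinrank_eq_finrank_quotient _ hN, hilbertSamuel, pow_one]
  let _ : Field (A ⧸ maximalIdeal A) := Ideal.Quotient.field _
  rw [Module.length_eq_of_surjective (R := A ⧸ maximalIdeal A) Ideal.Quotient.mk_surjective]
  exact Module.length_eq_finrank _ _

theorem hilbertSamuel_one_eq_spanFinrank [Module.Finite A E] :
    hilbertSamuel A E 1 = (⊤ : Submodule A E).spanFinrank := by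
  rw [← hilbertSamuel_congr (Submodule.topEquiv (R := A) (M := E)),
    hilbertSamuel_coe_one Module.Finite.fg_top]

theorem hilbertSamuel_self_one : hilbertSamuel A A 1 = 1 := by
  rw [hilbertSamuel, pow_one, smul_eq_mul, Ideal.mul_top, Module.length_eq_one_iff]
  exact isSimpleModule_iff_quot_maximal.2 ⟨_, maximalIdeal.isMaximal A, ⟨.refl _ _⟩⟩

theorem hilbertSamuel_pi (σ : Type*) [Fintype σ] (n : ℕ) :
    hilbertSamuel A (σ → A) n = Fintype.card σ * hilbertSamuel A A n := by
  classical
  have hpi : (maximalIdeal A ^ n • ⊤ : Submodule A (σ → A)) =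
      Submodule.pi Set.univ fun _ => (maximalIdeal A ^ n • ⊤ : Submodule A A) := by
    ext u
    rw [mem_smul_top_pi_iff, Submodule.mem_pi]
    simp
  rw [hilbertSamuel, hpi, (Submodule.quotientPi _).length_eq, Module.length_pi_of_fintype]
  simp [hilbertSamuel]

theorem hilbertSamuel_add (c k : ℕ) : hilbertSamuel A E (c + k) =
    hilbertSamuel A (maximalIdeal A ^ c • ⊤ : Submodule A E) k + hilbertSamuel A E c := by
  let N : Submodule A E := maximalIdeal A ^ c • ⊤
  have hle : (maximalIdeal A ^ (c + k) • ⊤ : Submodule A E) ≤ N :=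
    pow_smul_top_antitone _ (Nat.le_add_right c k)
  have hcomap : (maximalIdeal A ^ (c + k) • ⊤ : Submodule A E).comap N.subtype =
      maximalIdeal A ^ k • ⊤ := by
    refine Submodule.map_injective_of_injective N.injective_subtype ?_
    rw [Submodule.map_smul'', Submodule.map_top, Submodule.range_subtype,
      Submodule.map_comap_subtype, ← mul_smul, ← pow_add, add_comm k c, inf_eq_right.2 hle]
  rw [hilbertSamuel, length_quotient_eq_length_quotient_comap_add N.subtype, hcomap,
    Submodule.range_subtype, sup_eq_left.2 hle]
  rfl

theorem hilbertSamuel_self_two [IsNoetherianRing A] :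
    hilbertSamuel A A 2 = (maximalIdeal A).spanFinrank + 1 := by
  rw [hilbertSamuel_add 1 1, hilbertSamuel_coe_one (IsNoetherian.noetherian _),
    hilbertSamuel_self_one, pow_one, smul_eq_mul, Ideal.mul_top]

theorem hilbertSamuel_eq_of_exact {L F : Type*} [AddCommGroup L] [Module A L] [AddCommGroup F]
    [Module A F] {ι : L →ₗ[A] F} {ε : F →ₗ[A] E} (hex : Function.Exact ι ε)
    (hε : Function.Surjective ε) (n : ℕ) :
    hilbertSamuel A F n =
      Module.length A (L ⧸ (maximalIdeal A ^ n • ⊤ : Submodule A F).comap ι) +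
        hilbertSamuel A E n := by
  have hcomap : (maximalIdeal A ^ n • ⊤ : Submodule A E).comap ε =
      LinearMap.range ι ⊔ maximalIdeal A ^ n • ⊤ := by
    rw [← LinearMap.range_eq_top.2 hε, LinearMap.range_eq_map, ← Submodule.map_smul'',
      Submodule.comap_map_eq, hex.linearMap_ker_eq, sup_comm]
  have hE : hilbertSamuel A E n =
      Module.length A (F ⧸ LinearMap.range ι ⊔ maximalIdeal A ^ n • ⊤) := by
    rw [hilbertSamuel, length_quotient_eq_length_quotient_comap_add ε, hcomap,
      LinearMap.range_eq_top.2 hε, top_sup_eq, Module.length_eq_zero_iff.2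
        (Submodule.Quotient.subsingleton_iff.2 rfl), add_zero]
  rw [hE, hilbertSamuel, length_quotient_eq_length_quotient_comap_add ι]

theorem hilbertSamuel_one_eq_of_exact {L F : Type*} [AddCommGroup L] [Module A L] [AddCommGroup F]
    [Module A F] {ι : L →ₗ[A] F} {ε : F →ₗ[A] E} (hex : Function.Exact ι ε)
    (hε : Function.Surjective ε) (hι : LinearMap.range ι ≤ maximalIdeal A • ⊤) :
    hilbertSamuel A F 1 = hilbertSamuel A E 1 := by
  have hcomap : (maximalIdeal A ^ 1 • ⊤ : Submodule A F).comap ι = ⊤ := by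
    rwa [pow_one, ← top_le_iff, ← Submodule.map_le_iff_le_comap, Submodule.map_top]
  rw [hilbertSamuel_eq_of_exact hex hε, hcomap,
    Module.length_eq_zero_iff.2 (Submodule.Quotient.subsingleton_iff.2 rfl), zero_add]

end HilbertSamuelValues

section UlrichModules

variable {B : Type*} [CommRing B] [IsLocalRing B] {E : Type*} [AddCommGroup E] [Module B E]

theorem IsMaximalCohenMacaulay.supportDim_eq [IsNoetherianRing B]
    (h : IsMaximalCohenMacaulay B E) : Module.supportDim B E = ringKrullDim B := by
  have := h.finite
  have := h.nontrivial
  exact le_antisymm (Module.supportDim_le_ringKrullDim B E)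
    (h.depth_eq.ge.trans (depth_le_supportDim _))

theorem IsMaximalCohenMacaulay.exists_isSMulRegular (hB : 1 ≤ ringKrullDim B)
    (h : IsMaximalCohenMacaulay B E) : ∃ y ∈ maximalIdeal B, IsSMulRegular E y := by
  have hdepth : ((1 : ℕ) : ℕ∞) ≤ depth (maximalIdeal B) E :=
    WithBot.coe_le_coe.1 (hB.trans h.depth_eq.ge)
  obtain ⟨rs, hrs, hmem, hlen⟩ := exists_isWeaklyRegular_of_le_depth hdepth
  obtain ⟨y, rfl⟩ := List.length_eq_one_iff.1 hlen
  exact ⟨y, hmem y (by simp), (isWeaklyRegular_singleton_iff _ _).1 hrs⟩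

theorem eval_add_one_eq_of_natDegree_eq_one {P : Polynomial ℚ} (hP : P.natDegree = 1) (x : ℚ) :
    P.eval (x + 1) = P.eval x + P.leadingCoeff := by
  rw [Polynomial.leadingCoeff, hP]
  conv_lhs => rw [Polynomial.eq_X_add_C_of_natDegree_le_one hP.le]
  conv_rhs => rw [Polynomial.eq_X_add_C_of_natDegree_le_one hP.le]
  simp
  ring

theorem HasMultiplicity.eventually_hilbertSamuel_succ {e : ℕ} (h : HasMultiplicity B E e)
    (hdim : Module.supportDim B E = 1) :
    ∀ᶠ n in Filter.atTop, hilbertSamuel B E (n + 1) = hilbertSamuel B E n + e := by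
  obtain ⟨r, P, hr, hP, hdeg, hlead⟩ := h
  obtain rfl : r = 1 := by exact_mod_cast hr.symm.trans hdim
  rw [Nat.factorial_one, Nat.cast_one, mul_one] at hlead
  rw [← Filter.map_add_atTop_eq_nat 1, Filter.eventually_map]
  filter_upwards [hP, (Filter.tendsto_add_atTop_nat 1).eventually hP] with n ⟨l, hl, hPl⟩
    ⟨l', hl', hPl'⟩
  have hll' : l' = l + e := by
    rw [Nat.cast_add, Nat.cast_one, eval_add_one_eq_of_natDegree_eq_one hdeg, hPl, hlead] at hPl'
    exact_mod_cast hPl'.symm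
  rw [hilbertSamuel, hilbertSamuel, hl, hl', hll', Nat.cast_add]

theorem IsUlrich.hasUlrichGrowth [IsNoetherianRing B] (hB : ringKrullDim B = 1)
    (h : IsUlrich B E) : HasUlrichGrowth B E := by
  have hMCM := h.isMaximalCohenMacaulay
  have := hMCM.finite
  refine ⟨hMCM.exists_isSMulRegular hB.ge, ?_⟩
  rw [hilbertSamuel_one_eq_spanFinrank]
  exact h.hasMultiplicity.eventually_hilbertSamuel_succ (hMCM.supportDim_eq.trans hB)

theorem HasUlrichGrowth.of_surjective {A : Type*} [CommRing A] [IsLocalRing A] [Algebra A B]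
    [Module A E] [IsScalarTower A B E] (hsurj : Function.Surjective (algebraMap A B))
    (h : HasUlrichGrowth B E) : HasUlrichGrowth A E := by
  have := IsLocalHom.of_surjective (algebraMap A B) hsurj
  obtain ⟨y', hy', hyE⟩ := h.exists_isSMulRegular
  obtain ⟨y, rfl⟩ := hsurj y'
  rw [← Ideal.mem_comap, maximalIdeal_comap] at hy'
  refine ⟨⟨y, hy', (isSMulRegular_algebraMap_iff B).1 hyE⟩, ?_⟩
  simpa only [hilbertSamuel_eq_of_surjective hsurj (E := E)] using h.eventually_hilbertSamuel_succ

end UlrichModules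

section Syzygy

theorem isMaximalCohenMacaulay_of_isWeaklyRegular {A : Type*} [CommRing A] [IsLocalRing A]
    [IsNoetherianRing A] {M : Type*} [AddCommGroup M] [Module A M] [Module.Finite A M]
    [Nontrivial M] {rs : List A} (hrs : IsWeaklyRegular M rs) (hmem : ∀ r ∈ rs, r ∈ maximalIdeal A)
    (hdim : ringKrullDim A = rs.length) : IsMaximalCohenMacaulay A M where
  finite := inferInstance
  nontrivial := inferInstance
  depth_eq := by
    have hreg := (isRegular_iff_isWeaklyRegular_of_subset_maximalIdeal hmem).2 hrs
    refine le_antisymm ((depth_le_supportDim _).trans (Module.supportDim_le_ringKrullDim A M)) ?_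
    exact hdim.trans_le (WithBot.coe_le_coe.2 (le_depth_of_isRegular hreg hmem))

theorem isGradedCohenMacaulay_of_isWeaklyRegular {A : Type u} [CommRing A] [IsLocalRing A]
    [IsNoetherianRing A] {M : Type u} [AddCommGroup M] [Module A M] [Module.Finite A M]
    [Nontrivial M] {rs : List (AssocGradedRing A)} (hrs : IsWeaklyRegular (AssocGraded A M) rs)
    (hmem : ∀ r ∈ rs, r ∈ irrelevant A) (hdim : ringKrullDim (AssocGradedRing A) = rs.length) :
    IsGradedCohenMacaulay A (AssocGraded A M) := by
  have hlt := (AssocGraded.irrelevant_smul_top_ne_top (A := A) (M := M)).lt_top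
  have : Nontrivial (AssocGraded A M) := (Submodule.nontrivial_iff _).1 ⟨_, _, hlt.ne⟩
  have hreg : IsRegular (AssocGraded A M) rs := ⟨hrs, fun htop => hlt.not_ge <|
    htop.le.trans (Submodule.smul_mono_left (Ideal.span_le.2 hmem))⟩
  refine le_antisymm (depth_le_supportDim _) ((Module.supportDim_le_ringKrullDim _ _).trans ?_)
  exact hdim.trans_le (WithBot.coe_le_coe.2 (le_depth_of_isRegular hreg hmem))

theorem HasUlrichGrowth.comap_pow_smul_top_le {A : Type u} [CommRing A] [IsLocalRing A]
    [IsNoetherianRing A] {E : Type u} [AddCommGroup E] [Module A E] [Module.Finite A E]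
    (hE : HasUlrichGrowth A E) {L F : Type*} [AddCommGroup L] [Module A L] [AddCommGroup F]
    [Module A F] {ι : L →ₗ[A] F} {ε : F →ₗ[A] E} (hι : Function.Injective ι)
    (hex : Function.Exact ι ε) (hε : Function.Surjective ε) (n : ℕ) :
    (maximalIdeal A ^ (n + 1) • ⊤ : Submodule A F).comap ι ≤ maximalIdeal A ^ n • ⊤ := by
  intro m hm
  have hmem := hE.ker_inf_pow_smul_top_le hε n ⟨hex.apply_apply_eq_zero m, hm⟩
  rw [hex.linearMap_ker_eq, LinearMap.range_eq_map, ← Submodule.map_smul''] at hmem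
  obtain ⟨m', hm', h⟩ := hmem
  rwa [← hι h]

variable {A : Type u} [CommRing A] [IsCohenMacaulayLocalRing A]
  {E : Type u} [AddCommGroup E] [Module A E] [Module.Finite A E]
  {M : Type u} [AddCommGroup M] [Module A M] {σ : Type*} [Finite σ]
  {ι : M →ₗ[A] σ → A} {ε : (σ → A) →ₗ[A] E}

theorem isMaximalCohenMacaulay_of_exact (hdim : ringKrullDim A = 2) (hE : HasUlrichGrowth A E)
    [Nontrivial M] (hinj : Function.Injective ι) (hex : Function.Exact ι ε) :
    IsMaximalCohenMacaulay A M := by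
  obtain ⟨y, hy, hyE⟩ := hE.exists_isSMulRegular
  obtain ⟨a, ha, b, hb, hab⟩ := exists_isWeaklyRegular_pair_of_two_le_depth
    (IsCohenMacaulayLocalRing.two_le_depth hdim)
  obtain ⟨f, hf, g, hg, hfg⟩ := exists_isWeaklyRegular_pair_of_exact hinj hex ha hb
    (isWeaklyRegular_of_flat hab _) fun n hn => hyE.right_eq_zero_of_smul (hn y hy)
  have := Module.Finite.of_injective ι hinj
  exact isMaximalCohenMacaulay_of_isWeaklyRegular hfg
    (List.forall_mem_cons.2 ⟨hf, List.forall_mem_singleton.2 hg⟩) hdim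

theorem isGradedCohenMacaulay_of_exact (hdim : ringKrullDim A = 2)
    (hG : IsGradedCohenMacaulay A (AssocGradedRing A)) (hE : HasUlrichGrowth A E) [Nontrivial M]
    (hinj : Function.Injective ι) (hex : Function.Exact ι ε) (hε : Function.Surjective ε)
    (hι : LinearMap.range ι ≤ maximalIdeal A • ⊤) :
    IsGradedCohenMacaulay A (AssocGraded A M) := by
  cases nonempty_fintype σ
  have hdimG : ringKrullDim (AssocGradedRing A) = 2 := hG.ringKrullDim_eq.trans hdim
  have hdepthG : 2 ≤ depth (irrelevant A) (AssocGradedRing A) := by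
    rw [IsGradedCohenMacaulay, Module.supportDim_self_eq_ringKrullDim, hdimG] at hG
    exact WithBot.coe_le_coe.1 hG.ge
  obtain ⟨a, ha, b, hb, hab⟩ := exists_isWeaklyRegular_pair_of_two_le_depth hdepthG
  have hpow := hE.comap_pow_smul_top_le hinj hex hε
  obtain ⟨f, hf, g, hg, hfg⟩ := exists_isWeaklyRegular_pair_of_exact
    (AssocGraded.shiftPi_injective hι hpow) (AssocGraded.exact_shiftPi_cover hι hpow hex hε) ha hb
    (isWeaklyRegular_of_flat hab _)
    fun _ => AssocGraded.eq_zero_of_forall_irrelevant_smul_eq_zero hE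
  have := Module.Finite.of_injective ι hinj
  exact isGradedCohenMacaulay_of_isWeaklyRegular hfg
    (List.forall_mem_cons.2 ⟨hf, List.forall_mem_singleton.2 hg⟩) hdimG

end Syzygy

section FreeSyzygy

variable {A : Type u} [CommRing A] [IsLocalRing A] [IsNoetherianRing A]
  {E : Type u} [AddCommGroup E] [Module A E] [Module.Finite A E]
  {M : Type u} [AddCommGroup M] [Module A M]

theorem HasUlrichGrowth.hilbertSamuel_two_eq_of_exact (hE : HasUlrichGrowth A E) {F : Type*}
    [AddCommGroup F] [Module A F] {ι : M →ₗ[A] F} {ε : F →ₗ[A] E} (hinj : Function.Injective ι)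
    (hex : Function.Exact ι ε) (hε : Function.Surjective ε)
    (hι : LinearMap.range ι ≤ maximalIdeal A • ⊤) :
    hilbertSamuel A F 2 = hilbertSamuel A M 1 + hilbertSamuel A E 2 := by
  have hcomap : (maximalIdeal A ^ 2 • ⊤ : Submodule A F).comap ι = maximalIdeal A ^ 1 • ⊤ := by
    refine le_antisymm (hE.comap_pow_smul_top_le hinj hex hε 1) ?_
    rw [← Submodule.map_le_iff_le_comap, Submodule.map_smul'', Submodule.map_top, pow_two,
      mul_smul, pow_one]
    exact smul_mono_right _ hι
  rw [hilbertSamuel_eq_of_exact hex hε, hcomap]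
  rfl

theorem isRegularLocalRing_of_free_of_exact (hdim : ringKrullDim A = 2) (hE : HasUlrichGrowth A E)
    [Nontrivial E] [Module.Free A M] {σ : Type*} [Finite σ] {ι : M →ₗ[A] σ → A}
    {ε : (σ → A) →ₗ[A] E} (hinj : Function.Injective ι) (hex : Function.Exact ι ε)
    (hε : Function.Surjective ε) (hι : LinearMap.range ι ≤ maximalIdeal A • ⊤) :
    IsRegularLocalRing A := by
  cases nonempty_fintype σ
  have := Module.Finite.of_injective ι hinj
  have hrank : Module.finrank A M ≤ Fintype.card σ := by
    simpa using LinearMap.finrank_le_finrank_of_injective hinj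
  have hM : hilbertSamuel A M 1 = Module.finrank A M := by
    rw [hilbertSamuel_congr (Module.finBasis A M).equivFun, hilbertSamuel_pi,
      hilbertSamuel_self_one, mul_one, Fintype.card_fin]
  have hcard : Fintype.card σ * ((maximalIdeal A).spanFinrank + 1) =
      Module.finrank A M + (Fintype.card σ + Fintype.card σ) := by
    have htwo := hE.hilbertSamuel_two_eq_of_exact hinj hex hε hι
    rw [hE.hilbertSamuel_two, ← hilbertSamuel_one_eq_of_exact hex hε hι, hM, hilbertSamuel_pi,
      hilbertSamuel_pi, hilbertSamuel_self_one, hilbertSamuel_self_two, mul_one] at htwo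
    exact_mod_cast htwo
  have : Nonempty σ := not_isEmpty_iff.1 fun _ => not_subsingleton E hε.subsingleton
  have hgen : (maximalIdeal A).spanFinrank ≤ 2 := by
    have hpos : 0 < Fintype.card σ := Fintype.card_pos
    nlinarith
  refine .of_spanFinrank_maximalIdeal_le A ?_
  rw [hdim]
  exact_mod_cast hgen

end FreeSyzygy

section FirstSyzygy

theorem IsFirstSyzygy.exists_exact {A : Type*} [CommRing A] [IsLocalRing A] {E : Type*}
    [AddCommGroup E] [Module A E] {M : Type*} [AddCommGroup M] [Module A M]
    (h : IsFirstSyzygy A E M) :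
    ∃ (d : ℕ) (ι : M →ₗ[A] Fin d → A) (ε : (Fin d → A) →ₗ[A] E), Function.Injective ι ∧
      Function.Exact ι ε ∧ Function.Surjective ε ∧ LinearMap.range ι ≤ maximalIdeal A • ⊤ := by
  obtain ⟨d, ε, hε, hker, ⟨e⟩⟩ := h
  have hrange : LinearMap.range ((LinearMap.ker ε).subtype ∘ₗ e.toLinearMap) = LinearMap.ker ε := by
    rw [LinearMap.range_comp, LinearEquiv.range, Submodule.map_subtype_top]
  exact ⟨d, (LinearMap.ker ε).subtype ∘ₗ e.toLinearMap, ε,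
    (LinearMap.ker ε).injective_subtype.comp e.injective, LinearMap.exact_iff.2 hrange.symm, hε,
    hrange.trans_le hker⟩

theorem nontrivial_of_exact_of_annihilator_ne_bot {A : Type*} [CommRing A] {E : Type*}
    [AddCommGroup E] [Module A E] [Nontrivial E] (hE : Module.annihilator A E ≠ ⊥) {M : Type*}
    [AddCommGroup M] [Module A M] {σ : Type*} {ι : M →ₗ[A] σ → A} {ε : (σ → A) →ₗ[A] E}
    (hex : Function.Exact ι ε) (hε : Function.Surjective ε) : Nontrivial M := by
  by_contra hM
  rw [not_nontrivial_iff_subsingleton] at hM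
  have hinj : Function.Injective ε := by
    rw [← LinearMap.ker_eq_bot, hex.linearMap_ker_eq, LinearMap.range_eq_bot]
    exact Subsingleton.elim _ _
  have : Nonempty σ := not_isEmpty_iff.1 fun _ => not_subsingleton E hε.subsingleton
  refine hE ((LinearEquiv.ofBijective ε ⟨hinj, hε⟩).annihilator_eq.symm.trans ?_)
  exact Module.annihilator_eq_bot.2 inferInstance

theorem IsFirstSyzygy.isMaximalCohenMacaulay_and_isGradedCohenMacaulay {A : Type u} [CommRing A]
    [IsCohenMacaulayLocalRing A] (hdim : ringKrullDim A = 2)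
    (hG : IsGradedCohenMacaulay A (AssocGradedRing A)) (I : Ideal A) [IsLocalRing (A ⧸ I)]
    (E : Type u) [AddCommGroup E] [Module A E] [Module (A ⧸ I) E] [IsScalarTower A (A ⧸ I) E]
    (M : Type u) [AddCommGroup M] [Module A M] (hI : ringKrullDim (A ⧸ I) = 1)
    (hE : IsUlrich (A ⧸ I) E) (hM : IsFirstSyzygy A E M) :
    IsMaximalCohenMacaulay A M ∧ IsGradedCohenMacaulay A (AssocGraded A M) ∧
      (¬ IsRegularLocalRing A → ¬ Module.Free A M) := by
  obtain ⟨d, ι, ε, hinj, hex, hε, hι⟩ := hM.exists_exact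
  have := hE.isMaximalCohenMacaulay.nontrivial
  have : Module.Finite A E := Module.Finite.of_surjective ε hε
  have hgrowth := (hE.hasUlrichGrowth hI).of_surjective (A := A) Ideal.Quotient.mk_surjective
  have hI0 : I ≠ ⊥ := by
    rintro rfl
    rw [ringKrullDim_eq_of_ringEquiv (RingEquiv.quotientBot A), hdim] at hI
    exact absurd hI (by decide)
  have hann : I ≤ Module.annihilator A E := fun a ha => Module.mem_annihilator.2 fun z => by
    rw [← algebraMap_smul (A ⧸ I) a, Ideal.Quotient.algebraMap_eq,
      Ideal.Quotient.eq_zero_iff_mem.2 ha, zero_smul]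
  have := nontrivial_of_exact_of_annihilator_ne_bot (ne_bot_of_le_ne_bot hI0 hann) hex hε
  exact ⟨isMaximalCohenMacaulay_of_exact hdim hgrowth hinj hex,
    isGradedCohenMacaulay_of_exact hdim hG hgrowth hinj hex hε hι,
    fun hreg _ => hreg (isRegularLocalRing_of_free_of_exact hdim hgrowth hinj hex hε hι)⟩

theorem exists_isFirstSyzygy (A : Type u) [CommRing A] [IsLocalRing A]
    (E : Type u) [AddCommGroup E] [Module A E] [Module.Finite A E] :
    ∃ (M : Type u) (_ : AddCommGroup M) (_ : Module A M), IsFirstSyzygy A E M := by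
  let _ : Field (A ⧸ maximalIdeal A) := Ideal.Quotient.field _
  let V := E ⧸ (maximalIdeal A • ⊤ : Submodule A E)
  have : Module.Finite (A ⧸ maximalIdeal A) V := Module.Finite.of_restrictScalars_finite A _ _
  let b := Module.finBasis (A ⧸ maximalIdeal A) V
  choose v hv using fun i => Submodule.mkQ_surjective (maximalIdeal A • ⊤ : Submodule A E) (b i)
  let ε := Fintype.linearCombination A v
  have hmk : ∀ u, Submodule.mkQ (maximalIdeal A • ⊤ : Submodule A E) (ε u) =
      ∑ i, (Ideal.Quotient.mk (maximalIdeal A) (u i)) • b i := fun u => by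
    simp only [ε, Fintype.linearCombination_apply, map_sum, map_smul, hv]
    rfl
  refine ⟨LinearMap.ker ε, inferInstance, inferInstance, _, ε, ?_, ?_, ⟨.refl _ _⟩⟩
  · rw [← LinearMap.range_eq_top, ← IsLocalRing.map_mkQ_eq_top, eq_top_iff]
    intro z _
    choose u hu using fun i => Ideal.Quotient.mk_surjective (b.repr z i)
    refine ⟨ε u, LinearMap.mem_range_self _ _, ?_⟩
    simp only [hmk, hu]
    exact b.sum_repr z
  · intro u hu
    have hsum := hmk u
    rw [LinearMap.mem_ker.1 hu, map_zero] at hsum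
    exact mem_smul_top_pi_iff.2 fun i => Ideal.Quotient.eq_zero_iff_mem.1
      (Fintype.linearIndependent_iff.1 b.linearIndependent _ hsum.symm i)

end FirstSyzygy

section UlrichIdeals

open scoped Pointwise

variable {B : Type u} [CommRing B] [IsLocalRing B] [IsNoetherianRing B]

theorem isMaximalCohenMacaulay_of_isSMulRegular (hB : ringKrullDim B = 1) {E : Type*}
    [AddCommGroup E] [Module B E] [Module.Finite B E] [Nontrivial E] {y : B}
    (hy : y ∈ maximalIdeal B) (hyE : IsSMulRegular E y) : IsMaximalCohenMacaulay B E :=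
  isMaximalCohenMacaulay_of_isWeaklyRegular ((isWeaklyRegular_singleton_iff _ _).2 hyE)
    (List.forall_mem_singleton.2 hy) hB

theorem IsMaximalCohenMacaulay.isUlrich_of_hilbertSamuel_eq (hB : ringKrullDim B = 1) {E : Type*}
    [AddCommGroup E] [Module B E] (h : IsMaximalCohenMacaulay B E) {e : ℕ}
    (hE : ∀ n, hilbertSamuel B E n = n * e) : IsUlrich B E := by
  have := h.finite
  have := h.nontrivial
  have hone := hE 1
  have he : e = (⊤ : Submodule B E).spanFinrank := by
    rw [hilbertSamuel_one_eq_spanFinrank] at hone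
    exact_mod_cast (hone.trans (one_mul _)).symm
  have he0 : (e : ℚ) ≠ 0 := by
    intro h0
    rw [Nat.cast_eq_zero.1 h0, Nat.cast_zero, mul_zero, hilbertSamuel, Module.length_eq_zero_iff,
      Submodule.Quotient.subsingleton_iff, pow_one] at hone
    exact Submodule.top_ne_ideal_smul_of_le_jacobson_annihilator
      (IsLocalRing.maximalIdeal_le_jacobson _) hone.symm
  refine ⟨h, he ▸ ⟨1, .C (e : ℚ) * .X + .C (e : ℚ), ?_, .of_forall fun n => ⟨(n + 1) * e, ?_, ?_⟩,
    Polynomial.natDegree_linear he0, ?_⟩⟩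
  · rw [h.supportDim_eq, hB, Nat.cast_one]
  · exact_mod_cast hE (n + 1)
  · simp only [Polynomial.eval_add, Polynomial.eval_mul, Polynomial.eval_C, Polynomial.eval_X]
    push_cast
    ring
  · rw [Polynomial.leadingCoeff_linear he0, Nat.factorial_one, Nat.cast_one, mul_one]

theorem exists_hilbertSamuel_pow_smul_top_eq {E : Type u} [AddCommGroup E] [Module B E]
    [Module.Finite B E] {e : ℕ∞}
    (he : ∀ᶠ n in Filter.atTop, hilbertSamuel B E (n + 1) = hilbertSamuel B E n + e) :
    ∃ c : ℕ, ∀ k, hilbertSamuel B (maximalIdeal B ^ c • ⊤ : Submodule B E) k = k * e := by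
  obtain ⟨c, hc⟩ := Filter.eventually_atTop.1 he
  have hlinear : ∀ k : ℕ, hilbertSamuel B E (c + k) = k * e + hilbertSamuel B E c := by
    intro k
    induction k with
    | zero => simp
    | succ k ih =>
      rw [← add_assoc, hc _ (by omega), ih]
      push_cast
      ring
  exact ⟨c, fun k => (ENat.addLECancellable_of_ne_top (hilbertSamuel_ne_top c)).inj_left.1
    ((hilbertSamuel_add c k).symm.trans (hlinear k))⟩

theorem length_quotSMulTop_ne_top (hB : ringKrullDim B = 1) {y : B} (hy : y ∈ maximalIdeal B)
    (hyB : IsSMulRegular B y) : Module.length B (QuotSMulTop y B) ≠ ⊤ := by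
  have hdim := ringKrullDim_quotSMulTop_succ_eq_ringKrullDim hyB hy
  have : IsArtinianRing (B ⧸ (y • ⊤ : Ideal B)) := by
    rw [isArtinianRing_iff_krullDimLE_zero, Ring.krullDimLE_iff]
    exact ENat.WithBot.add_le_add_one_right_iff.1 (by rw [hdim, hB]; rfl)
  rw [Module.length_eq_of_surjective (R := B ⧸ (y • ⊤ : Ideal B)) Ideal.Quotient.mk_surjective]
  exact Module.length_ne_top

theorem exists_isUlrich_maximalIdeal_pow (hB : ringKrullDim B = 1) {y : B}
    (hy : y ∈ maximalIdeal B) (hyB : IsSMulRegular B y) :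
    ∃ c : ℕ, IsUlrich B (maximalIdeal B ^ c : Ideal B) := by
  obtain ⟨e, he⟩ := exists_eventually_hilbertSamuel_succ hy hyB
    (length_quotSMulTop_ne_top hB hy hyB)
  obtain ⟨c, hc⟩ := exists_hilbertSamuel_pow_smul_top_eq he
  rw [smul_eq_mul, Ideal.mul_top] at hc
  have : Nontrivial (maximalIdeal B ^ c : Ideal B) := by
    refine Submodule.nontrivial_iff_ne_bot.2
      ((Submodule.ne_bot_iff _).2 ⟨y ^ c, Ideal.pow_mem_pow hy c, fun h => ?_⟩)
    exact one_ne_zero ((hyB.pow c).right_eq_zero_of_smul (x := (1 : B)) (by simp [h]))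
  lift e to ℕ using fun htop => hilbertSamuel_ne_top 1 ((hc 1).trans (by simp [htop]))
  exact ⟨c, (isMaximalCohenMacaulay_of_isSMulRegular hB hy
    (hyB.submodule _ y)).isUlrich_of_hilbertSamuel_eq hB hc⟩

theorem exists_isUlrich_quotient {A : Type u} [CommRing A] [IsCohenMacaulayLocalRing A]
    (hdim : ringKrullDim A = 2) :
    ∃ (I : Ideal A) (_ : IsCohenMacaulayLocalRing (A ⧸ I)) (J : Ideal (A ⧸ I)),
      ringKrullDim (A ⧸ I) = 1 ∧ IsUlrich (A ⧸ I) J := by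
  obtain ⟨x, hx, y, hy, hxy⟩ := exists_isWeaklyRegular_pair_of_two_le_depth
    (IsCohenMacaulayLocalRing.two_le_depth hdim)
  obtain ⟨hxA, hyB⟩ := isWeaklyRegular_pair_iff.1 hxy
  let B := A ⧸ (x • ⊤ : Ideal A)
  have hsurj : Function.Surjective (algebraMap A B) := Ideal.Quotient.mk_surjective
  have : Nontrivial B := nontrivial_quotSMulTop_of_mem_maximalIdeal A hx
  have : IsLocalRing B := .of_surjective' (Ideal.Quotient.mk _) hsurj
  have := IsLocalHom.of_surjective (algebraMap A B) hsurj
  have hB : ringKrullDim B = 1 := by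
    have h := ringKrullDim_quotSMulTop_succ_eq_ringKrullDim hxA hx
    exact ENat.WithBot.add_one_cancel.1 (h.trans (hdim.trans (by rfl)))
  have hyB' : IsSMulRegular B (algebraMap A B y) := (isSMulRegular_algebraMap_iff B).2 hyB
  have hy' : algebraMap A B y ∈ maximalIdeal B := by
    rwa [← Ideal.mem_comap, maximalIdeal_comap]
  obtain ⟨c, hc⟩ := exists_isUlrich_maximalIdeal_pow hB hy' hyB'
  have hCM := isMaximalCohenMacaulay_of_isSMulRegular hB hy' hyB'
  exact ⟨x • ⊤, { depth_eq := hCM.depth_eq }, _, hB, hc⟩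

end UlrichIdeals

end GradedCM

end

open GradedCM in
theorem theorem9 (A : Type u) [CommRing A] [IsCohenMacaulayLocalRing A]
    (hdim : ringKrullDim A = 2) (hG : IsGradedCohenMacaulay A (AssocGradedRing A)) :
    (∃ (I : Ideal A) (_ : IsCohenMacaulayLocalRing (A ⧸ I))
      (E : Type u) (_ : AddCommGroup E) (_ : Module A E) (_ : Module (A ⧸ I) E)
      (_ : IsScalarTower A (A ⧸ I) E)
      (M : Type u) (_ : AddCommGroup M) (_ : Module A M),
      ringKrullDim (A ⧸ I) = 1 ∧ IsUlrich (A ⧸ I) E ∧ IsFirstSyzygy A E M ∧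
      IsMaximalCohenMacaulay A M ∧ IsGradedCohenMacaulay A (AssocGraded A M) ∧
      (¬ IsRegularLocalRing A → ¬ Module.Free A M)) ∧
    (∀ (I : Ideal A) [IsCohenMacaulayLocalRing (A ⧸ I)]
      (E : Type u) [AddCommGroup E] [Module A E] [Module (A ⧸ I) E] [IsScalarTower A (A ⧸ I) E]
      (M : Type u) [AddCommGroup M] [Module A M],
      ringKrullDim (A ⧸ I) = 1 → IsUlrich (A ⧸ I) E → IsFirstSyzygy A E M →
      IsMaximalCohenMacaulay A M ∧ IsGradedCohenMacaulay A (AssocGraded A M) ∧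
      (¬ IsRegularLocalRing A → ¬ Module.Free A M)) := by
  refine ⟨?_, fun I _ E _ _ _ _ M _ _ =>
    IsFirstSyzygy.isMaximalCohenMacaulay_and_isGradedCohenMacaulay hdim hG I E M⟩
  obtain ⟨I, hI, J, hI1, hJ⟩ := exists_isUlrich_quotient hdim
  have : Module.Finite (A ⧸ I) J := hJ.isMaximalCohenMacaulay.finite
  have : Module.Finite A J := Module.Finite.trans (A ⧸ I) J
  obtain ⟨M, _, _, hM⟩ := exists_isFirstSyzygy A J
  exact ⟨I, hI, J, inferInstance, inferInstance, inferInstance, inferInstance, M, inferInstance,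
    inferInstance, hI1, hJ, hM, IsFirstSyzygy.isMaximalCohenMacaulay_and_isGradedCohenMacaulay
      hdim hG I J M hI1 hJ hM⟩
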